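/- Let $d\in\mathbb N$, $Y=[0,2\pi)^d$, and write $\mathcal M_Y(f)=\frac1{|Y|}\int_Y f\,dy$. Let $A=(a_{kl})_{k,l=1}^d$ be a symmetric matrix of real, bounded, measurable, $2\pi\mathbb Z^d$-periodic functions on $\mathbb R^d$ for which there is $\alpha>0$ with $A(y)\xi\cdot\xi\ge\alpha|\xi|^2$ for all $\xi\in\mathbb R^d$ and a.e. $y$. Let $H^s_\sharp(Y)$ ($s=1,2$) denote the Sobolev spaces of real-valued $2\pi\mathbb Z^d$-periodic functions, and put $V_\rho=H^2_\sharp(Y)$ for $\rho>0$ and $V_0=H^1_\sharp(Y)$. For every $0\le\rho<\infty$ and $1\le j\le d$ the cell problem $$\rho^2\Delta^2\chi_j^\rho-\operatorname{div}A(y)(e_j+\nabla\chi_j^\rho)=0,\qquad \chi_j^\rho\ \ Y\text{-periodic},\qquad \mathcal M_Y(\chi_j^\rho)=0,$$ understood weakly, i.e. $\chi^\rho_j\in V_\rho$, $\mathcal M_Y(\chi_j^\rho)=0$ and $$\rho^2\int_Y\Delta\chi_j^\rho\,\Delta v\,dy+\int_Y A(e_j+\nabla\chi_j^\rho)\cdot\nabla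 v\,dy=0\qquad\text{for all }v\in V_\rho$$ (the first term being absent for $\rho=0$), has a solution, unique up to equality almost everywhere. Define $A^{\rho,\mathrm{hom}}=\mathcal M_Y(A+A\nabla\chi^\rho)$, i.e. $A^{\rho,\mathrm{hom}}e_l=\mathcal M_Y\big(A(e_l+\nabla\chi_l^\rho)\big)$ for $1\le l\le d$. Let $\theta\in[0,\infty]$, and set $A^{\mathrm{hom}}=A^{\theta,\mathrm{hom}}$ if $\theta<\infty$ and $A^{\mathrm{hom}}=\mathcal M_Y(A)$ if $\theta=\infty$. Then $A^{\rho,\mathrm{hom}}\to A^{\mathrm{hom}}$ as $\rho\to\theta$ with $0\le\rho<\infty$. -/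

import Mathlib

open MeasureTheory Filter Topology
open scoped NNReal ENNReal Matrix

namespace PeriodicHom

noncomputable section

/-- The periodicity cell `Y = [0, 2π)^d`. -/
def cell (d : ℕ) : Set (Fin d → ℝ) :=
  Set.pi Set.univ (fun _ => Set.Ico 0 (2 * Real.pi))

/-- The lattice translate `y + 2πp` of `y`. -/
def shift {d : ℕ} (p : Fin d → ℤ) (y : Fin d → ℝ) : Fin d → ℝ :=
  fun i => y i + 2 * Real.pi * (p i : ℝ)

/-- `f` is `Y`-periodic (as a function defined almost everywhere). -/
def AEPeriodic {d : ℕ} {E : Type*} (f : (Fin d → ℝ) → E) : Prop :=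
  ∀ p : Fin d → ℤ, ∀ᵐ y : Fin d → ℝ, f (shift p y) = f y

/-- The standing hypotheses on the coefficient matrix: entries real, bounded and measurable;
uniform ellipticity; periodicity; symmetry. -/
structure IsAdmissible {d : ℕ} (A : (Fin d → ℝ) → Matrix (Fin d) (Fin d) ℝ) : Prop where
  measurable : ∀ k l, AEMeasurable (fun y => A y k l)
  bounded : ∃ M : ℝ, ∀ᵐ y : Fin d → ℝ, ∀ k l, |A y k l| ≤ M
  elliptic : ∃ α : ℝ, 0 < α ∧
    ∀ᵐ y : Fin d → ℝ, ∀ ξ : Fin d → ℝ, α * (ξ ⬝ᵥ ξ) ≤ (A y *ᵥ ξ) ⬝ᵥ ξ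
  periodic : AEPeriodic A
  symmetric : ∀ᵐ y : Fin d → ℝ, (A y).IsSymm

/-- The space `L²_♯(Y)` of (real) periodic functions that are square integrable on `Y`. -/
def MemL2 {d : ℕ} (u : (Fin d → ℝ) → ℝ) : Prop :=
  AEPeriodic u ∧ MemLp u 2 (volume.restrict (cell d))

/-- Smooth periodic test functions, the space `C^∞_♯(Y)`. -/
def IsTest {d : ℕ} (φ : (Fin d → ℝ) → ℝ) : Prop :=
  ContDiff ℝ ((⊤ : ℕ∞) : WithTop ℕ∞) φ ∧ ∀ (p : Fin d → ℤ) (y : Fin d → ℝ), φ (shift p y) = φ y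

/-- `g ∈ L²_♯(Y)` is the weak partial derivative `∂u/∂y_m` of the periodic function `u`. -/
def IsWeakPartial {d : ℕ} (m : Fin d) (u g : (Fin d → ℝ) → ℝ) : Prop :=
  MemL2 g ∧ ∀ φ : (Fin d → ℝ) → ℝ, IsTest φ →
    ∫ y in cell d, u y * fderiv ℝ φ y (Pi.single m 1) = - ∫ y in cell d, g y * φ y

/-- The Sobolev space `H¹_♯(Y)`. -/
def MemH1 {d : ℕ} (u : (Fin d → ℝ) → ℝ) : Prop :=
  MemL2 u ∧ ∀ m, ∃ g, IsWeakPartial m u g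

/-- The Sobolev space `H²_♯(Y)`. -/
def MemH2 {d : ℕ} (u : (Fin d → ℝ) → ℝ) : Prop :=
  MemL2 u ∧ ∀ m, ∃ g, IsWeakPartial m u g ∧ MemH1 g

open Classical in
/-- The weak partial derivative `∂u/∂y_m` (determined up to null sets when it exists). -/
def weakPartial {d : ℕ} (m : Fin d) (u : (Fin d → ℝ) → ℝ) : (Fin d → ℝ) → ℝ :=
  if h : ∃ g, IsWeakPartial m u g then h.choose else 0

/-- The weak gradient. -/
def weakGrad {d : ℕ} (u : (Fin d → ℝ) → ℝ) (y : Fin d → ℝ) : Fin d → ℝ :=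
  fun m => weakPartial m u y

/-- The weak Laplacian of a function in `H²_♯(Y)`. -/
def weakLaplacian {d : ℕ} (u : (Fin d → ℝ) → ℝ) (y : Fin d → ℝ) : ℝ :=
  ∑ m, weakPartial m (weakPartial m u) y

/-- The energy space of `ρ²Δ² - div A∇`: it is `H²_♯(Y)` for `ρ ≠ 0` and `H¹_♯(Y)` for `ρ = 0`. -/
def MemEnergy {d : ℕ} (ρ : ℝ) (u : (Fin d → ℝ) → ℝ) : Prop :=
  (ρ = 0 ∧ MemH1 u) ∨ (ρ ≠ 0 ∧ MemH2 u)

/-- `χ` is a weak solution of the cell problem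
`ρ²Δ²χ - div A(e_j + ∇χ) = 0`, `χ` periodic with mean zero. -/
def IsCorrector {d : ℕ} (A : (Fin d → ℝ) → Matrix (Fin d) (Fin d) ℝ) (ρ : ℝ) (j : Fin d)
    (χ : (Fin d → ℝ) → ℝ) : Prop :=
  MemEnergy ρ χ ∧ (⨍ y in cell d, χ y) = 0 ∧
    ∀ v : (Fin d → ℝ) → ℝ, MemEnergy ρ v →
      ρ ^ 2 * (∫ y in cell d, weakLaplacian χ y * weakLaplacian v y) +
        (∫ y in cell d, (A y *ᵥ (Pi.single j 1 + weakGrad χ y)) ⬝ᵥ weakGrad v y) = 0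

open Classical in
/-- The corrector `χ_j^ρ` (determined up to null sets). -/
def corrector {d : ℕ} (A : (Fin d → ℝ) → Matrix (Fin d) (Fin d) ℝ) (ρ : ℝ) (j : Fin d) :
    (Fin d → ℝ) → ℝ :=
  if h : ∃ χ, IsCorrector A ρ j χ then h.choose else 0

/-- The mean `M_Y(A)`. -/
def meanMatrix {d : ℕ} (A : (Fin d → ℝ) → Matrix (Fin d) (Fin d) ℝ) :
    Matrix (Fin d) (Fin d) ℝ :=
  Matrix.of fun k l => ⨍ y in cell d, A y k l

/-- `A^{ρ,hom} = M_Y(A + A∇χ^ρ)`; its `l`-th column is `M_Y(A(e_l + ∇χ_l^ρ))`. -/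
def homTensor {d : ℕ} (A : (Fin d → ℝ) → Matrix (Fin d) (Fin d) ℝ) (ρ : ℝ) :
    Matrix (Fin d) (Fin d) ℝ :=
  Matrix.of fun k l => ⨍ y in cell d, (A y k l + (A y *ᵥ weakGrad (corrector A ρ l) y) k)

open Classical in
/-- The homogenized tensor `A^{hom}` in the regime `ρ → θ ∈ [0, ∞]`. -/
def limitTensor {d : ℕ} (A : (Fin d → ℝ) → Matrix (Fin d) (Fin d) ℝ) (θ : ℝ≥0∞) :
    Matrix (Fin d) (Fin d) ℝ :=
  if θ = ⊤ then meanMatrix A else homTensor A θ.toReal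

end

end PeriodicHom

/-
A weak derivative is the same thing as multiplication of the Fourier coefficients by `i k_m`, so the
mean-zero parts of `H¹_♯(Y)` and `H²_♯(Y)` are Hilbert spaces on which `‖u‖ ≤ ‖∇u‖ ≤ ‖Δu‖` holds
frequency by frequency. Hence the cell problem is coercive and the Lax–Milgram theorem applies.
Subtracting the weak formulations for two parameters and testing with an approximation in `H²_♯(Y)`
of one of the correctors gives a Céa-type estimate, and because gradients of `H²_♯(Y)` are dense in
those of `H¹_♯(Y)`, it yields continuity of `ρ ↦ ∇χ^ρ`, including at the singular limit `ρ = 0`.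
Testing the equation with the corrector itself bounds `ρ² ‖Δχ^ρ‖`, so that `∇χ^ρ → 0` as `ρ → ∞`.
Finally `A^{ρ,hom}` depends continuously on `∇χ^ρ` alone.
-/

namespace PeriodicHom

noncomputable section

variable {d : ℕ}

/-- Lebesgue measure on the periodicity cell. -/
abbrev cellMeasure (d : ℕ) : Measure (Fin d → ℝ) := volume.restrict (cell d)

theorem measurableSet_cell (d : ℕ) : MeasurableSet (cell d) :=
  MeasurableSet.univ_pi fun _ => measurableSet_Ico

theorem cell_ae_eq_Icc (d : ℕ) :
    cell d =ᵐ[volume] Set.Icc (fun _ => (0 : ℝ)) (fun _ => 2 * Real.pi) :=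
  Measure.univ_pi_Ico_ae_eq_Icc

theorem cell_ae_eq_Ioc (d : ℕ) :
    cell d =ᵐ[volume] Set.pi Set.univ (fun _ => Set.Ioc (0 : ℝ) (2 * Real.pi)) :=
  (cell_ae_eq_Icc d).trans Measure.univ_pi_Ioc_ae_eq_Icc.symm

theorem volume_cell (d : ℕ) : volume (cell d) = ENNReal.ofReal (2 * Real.pi) ^ d := by
  simp [cell, volume_pi, Measure.pi_pi]

theorem volume_real_cell (d : ℕ) : volume.real (cell d) = (2 * Real.pi) ^ d := by
  simp [Measure.real, volume_cell, ENNReal.toReal_pow, Real.pi_pos.le]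

instance (d : ℕ) : IsFiniteMeasure (cellMeasure d) :=
  ⟨by
    rw [Measure.restrict_apply_univ, volume_cell]
    exact ENNReal.pow_lt_top ENNReal.ofReal_lt_top⟩

theorem average_cell (f : (Fin d → ℝ) → ℝ) :
    ⨍ y in cell d, f y = ((2 * Real.pi) ^ d)⁻¹ * ∫ y in cell d, f y := by
  rw [setAverage_eq, volume_real_cell, smul_eq_mul]

theorem average_cell_eq_zero {f : (Fin d → ℝ) → ℝ} :
    ⨍ y in cell d, f y = 0 ↔ ∫ y in cell d, f y = 0 := by
  simp [average_cell, Real.pi_ne_zero]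

/-- Reduction of a point modulo the period lattice to the periodicity cell. -/
def reduce (y : Fin d → ℝ) : Fin d → ℝ :=
  fun i => toIcoMod Real.two_pi_pos 0 (y i)

theorem reduce_mem_cell (y : Fin d → ℝ) : reduce y ∈ cell d := by
  intro i _
  simpa [reduce] using toIcoMod_mem_Ico Real.two_pi_pos 0 (y i)

theorem reduce_of_mem_cell {y : Fin d → ℝ} (hy : y ∈ cell d) : reduce y = y := by
  funext i
  exact (toIcoMod_eq_self Real.two_pi_pos).2 (by simpa using hy i trivial)

theorem reduce_shift (p : Fin d → ℤ) (y : Fin d → ℝ) : reduce (shift p y) = reduce y := by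
  funext i
  have h := toIcoMod_add_zsmul Real.two_pi_pos 0 (y i) (p i)
  rwa [zsmul_eq_mul, mul_comm ((p i : ℤ) : ℝ)] at h

theorem exists_shift_eq_reduce (y : Fin d → ℝ) : ∃ p : Fin d → ℤ, shift p y = reduce y := by
  refine ⟨fun i => -toIcoDiv Real.two_pi_pos 0 (y i), funext fun i => ?_⟩
  simp only [shift, reduce, toIcoMod, zsmul_eq_mul, Int.cast_neg]
  ring

theorem measurePreserving_shift (p : Fin d → ℤ) :
    MeasurePreserving (shift p : (Fin d → ℝ) → Fin d → ℝ) volume volume :=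
  measurePreserving_add_right volume (fun i => 2 * Real.pi * (p i : ℝ))

theorem AEPeriodic.ae_eq {E : Type*} {f g : (Fin d → ℝ) → E} (hf : AEPeriodic f)
    (hg : AEPeriodic g) (h : f =ᵐ[cellMeasure d] g) : f =ᵐ[volume] g := by
  have h_cell : ∀ᵐ y : Fin d → ℝ, y ∈ cell d → f y = g y :=
    (ae_restrict_iff' (measurableSet_cell d)).1 h
  have h_shift : ∀ᵐ y : Fin d → ℝ, ∀ p, shift p y ∈ cell d → f (shift p y) = g (shift p y) :=
    ae_all_iff.2 fun p => (measurePreserving_shift p).quasiMeasurePreserving.ae h_cell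
  filter_upwards [h_shift, ae_all_iff.2 hf, ae_all_iff.2 hg] with y hy hfy hgy
  obtain ⟨p, hp⟩ := exists_shift_eq_reduce y
  rw [← hfy p, ← hgy p]
  exact hy p (hp ▸ reduce_mem_cell y)

theorem aePeriodic_comp_reduce {E : Type*} (f : (Fin d → ℝ) → E) :
    AEPeriodic (fun y => f (reduce y)) := fun p => by
  simp [reduce_shift]

theorem comp_reduce_ae_eq {E : Type*} (f : (Fin d → ℝ) → E) :
    (fun y => f (reduce y)) =ᵐ[cellMeasure d] f := by
  filter_upwards [ae_restrict_mem (measurableSet_cell d)] with y hy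
  rw [reduce_of_mem_cell hy]

theorem memL2_comp_reduce {f : (Fin d → ℝ) → ℝ} (hf : MemLp f 2 (cellMeasure d)) :
    MemL2 (fun y => f (reduce y)) :=
  ⟨aePeriodic_comp_reduce f, hf.ae_eq (comp_reduce_ae_eq f).symm⟩

theorem memLp_cell_of_continuous {f : (Fin d → ℝ) → ℝ} (hf : Continuous f) (p : ℝ≥0∞) :
    MemLp f p (cellMeasure d) := by
  obtain ⟨C, hC⟩ := (isCompact_Icc (a := fun _ : Fin d => (0 : ℝ))
    (b := fun _ => 2 * Real.pi)).exists_bound_of_continuousOn hf.continuousOn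
  refine MemLp.of_bound hf.aestronglyMeasurable C ?_
  filter_upwards [ae_restrict_mem (measurableSet_cell d)] with y hy
  exact hC y ⟨fun i => (hy i trivial).1, fun i => (hy i trivial).2.le⟩

namespace IsTest

variable {φ ψ : (Fin d → ℝ) → ℝ}

theorem continuous (hφ : IsTest φ) : Continuous φ :=
  hφ.1.continuous

theorem differentiable (hφ : IsTest φ) : Differentiable ℝ φ :=
  hφ.1.differentiable (by simp)

theorem mul (hφ : IsTest φ) (hψ : IsTest ψ) : IsTest (fun y => φ y * ψ y) :=
  ⟨hφ.1.mul hψ.1, fun p y => congrArg₂ (· * ·) (hφ.2 p y) (hψ.2 p y)⟩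

theorem fderiv_apply (hφ : IsTest φ) (v : Fin d → ℝ) : IsTest (fun y => fderiv ℝ φ y v) := by
  refine ⟨(hφ.1.fderiv_right (by simp)).clm_apply contDiff_const, fun p y => ?_⟩
  have hφp : (fun z => φ (z + fun i => 2 * Real.pi * (p i : ℝ))) = φ := funext (hφ.2 p)
  have h := fderiv_comp_add_right (𝕜 := ℝ) (f := φ) (x := y) fun i => 2 * Real.pi * (p i : ℝ)
  rw [hφp] at h
  exact congrArg (fun L => L v) h.symm

theorem memL2 (hφ : IsTest φ) : MemL2 φ :=
  ⟨fun p => Eventually.of_forall (hφ.2 p), memLp_cell_of_continuous hφ.continuous 2⟩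

theorem integral_fderiv_eq_zero (hφ : IsTest φ) (m : Fin d) :
    ∫ y in cell d, fderiv ℝ φ y (Pi.single m 1) = 0 := by
  obtain _ | n := d
  · exact m.elim0
  let ι : ℝ →L[ℝ] (Fin (n + 1) → ℝ) := ContinuousLinearMap.single ℝ (fun _ => ℝ) m
  have h_div : ∀ y, ∑ i, (ι ∘L fderiv ℝ φ y) (Pi.single i 1) i =
      fderiv ℝ φ y (Pi.single m 1) := fun y => by
    simp [ι, Pi.single_apply]
  have h_faces := integral_divergence_of_hasFDerivAt_off_countable
    (fun _ : Fin (n + 1) => (0 : ℝ)) (fun _ => 2 * Real.pi) (fun _ => Real.two_pi_pos.le)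
    (fun y => ι (φ y)) (fun y => ι ∘L fderiv ℝ φ y) ∅ Set.countable_empty
    (ι.continuous.comp hφ.continuous).continuousOn
    (fun y _ => ι.hasFDerivAt.comp y (hφ.differentiable y).hasFDerivAt)
    (by
      simp only [h_div]
      exact (hφ.fderiv_apply _).continuous.continuousOn.integrableOn_compact isCompact_Icc)
  simp only [h_div] at h_faces
  rw [setIntegral_congr_set (cell_ae_eq_Icc _), h_faces]
  refine Finset.sum_eq_zero fun i _ => sub_eq_zero.2 (congrArg _ (funext fun x => ?_))
  have h_opposite : shift (Pi.single i 1) (i.insertNth 0 x : Fin (n + 1) → ℝ) =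
      i.insertNth (2 * Real.pi) x := by
    refine funext (Fin.succAboveCases i ?_ fun j => ?_) <;> simp [shift, Fin.succAbove_ne]
  rw [← h_opposite, hφ.2]

theorem integral_mul_fderiv (hφ : IsTest φ) (hψ : IsTest ψ) (m : Fin d) :
    ∫ y in cell d, φ y * fderiv ℝ ψ y (Pi.single m 1) =
      - ∫ y in cell d, fderiv ℝ φ y (Pi.single m 1) * ψ y := by
  have h_leibniz : ∀ y, fderiv ℝ (fun y => φ y * ψ y) y (Pi.single m 1) =
      φ y * fderiv ℝ ψ y (Pi.single m 1) + fderiv ℝ φ y (Pi.single m 1) * ψ y := fun y => by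
    rw [fderiv_fun_mul (hφ.differentiable y) (hψ.differentiable y)]
    simp [mul_comm]
  have integrable {η : (Fin d → ℝ) → ℝ} (hη : IsTest η) : Integrable η (cellMeasure d) :=
    hη.memL2.2.integrable one_le_two
  rw [eq_neg_iff_add_eq_zero, ← integral_add (integrable (hφ.mul (hψ.fderiv_apply _)))
    (integrable ((hφ.fderiv_apply _).mul hψ)), ← (hφ.mul hψ).integral_fderiv_eq_zero m]
  simp only [h_leibniz]

theorem isWeakPartial (hφ : IsTest φ) (m : Fin d) :
    IsWeakPartial m φ (fun y => fderiv ℝ φ y (Pi.single m 1)) :=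
  ⟨(hφ.fderiv_apply _).memL2, fun _ hψ => hφ.integral_mul_fderiv hψ m⟩

theorem memH1 (hφ : IsTest φ) : MemH1 φ :=
  ⟨hφ.memL2, fun m => ⟨_, hφ.isWeakPartial m⟩⟩

theorem memH2 (hφ : IsTest φ) : MemH2 φ :=
  ⟨hφ.memL2, fun m => ⟨_, hφ.isWeakPartial m, (hφ.fderiv_apply _).memH1⟩⟩

end IsTest

/-- The real plane wave `cos (k · y + s)` of frequency `k` and phase shift `s`; the shifts `0` and
`π / 2` give the real and imaginary parts of `exp (-i k · y)`. -/
def wave (k : Fin d → ℤ) (s : ℝ) (y : Fin d → ℝ) : ℝ :=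
  Real.cos ((∑ i, (k i : ℝ) * y i) + s)

theorem isTest_wave (k : Fin d → ℤ) (s : ℝ) : IsTest (wave k s) := by
  refine ⟨by unfold wave; fun_prop, fun p y => ?_⟩
  have h : (∑ i, (k i : ℝ) * shift p y i) + s =
      ((∑ i, (k i : ℝ) * y i) + s) + ((∑ i, k i * p i : ℤ) : ℝ) * (2 * Real.pi) := by
    simp only [shift, mul_add, Finset.sum_add_distrib, Int.cast_sum, Int.cast_mul, Finset.sum_mul]
    rw [add_right_comm]
    congr! 2
    ring
  rw [wave, h, Real.cos_add_int_mul_two_pi, wave]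

theorem fderiv_wave (k : Fin d → ℤ) (s : ℝ) (m : Fin d) (y : Fin d → ℝ) :
    fderiv ℝ (wave k s) y (Pi.single m 1) = k m * wave k (s + Real.pi / 2) y := by
  have h_phase : HasFDerivAt (fun y : Fin d → ℝ => (∑ i, (k i : ℝ) * y i) + s)
      (∑ i, (k i : ℝ) • ContinuousLinearMap.proj (R := ℝ) (φ := fun _ : Fin d => ℝ) i) y :=
    (HasFDerivAt.fun_sum fun i _ => (hasFDerivAt_apply i y).const_mul _).add_const _
  have h_wave : HasFDerivAt (wave k s) _ y := h_phase.cos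
  rw [h_wave.fderiv]
  simp [wave, Pi.single_apply, ← add_assoc, Real.cos_add_pi_div_two, mul_comm]

/-- The Hilbert space of square integrable functions on the periodicity cell. -/
abbrev L2Cell (d : ℕ) : Type := Lp ℝ 2 (cellMeasure d)

/-- The class in `L2Cell d` of the plane wave `wave k s`. -/
def waveLp (k : Fin d → ℤ) (s : ℝ) : L2Cell d := (isTest_wave k s).memL2.2.toLp _

/-- The unnormalised Fourier coefficient `∫_Y exp (-i k · y) U y dy`, as a bounded functional on
the real space `L2Cell d`. -/
def cellFourierCoeff (k : Fin d → ℤ) : L2Cell d →L[ℝ] ℂ :=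
  Complex.equivRealProdCLM.symm ∘L
    (innerSL ℝ (waveLp k 0)).prod (innerSL ℝ (waveLp k (Real.pi / 2)))

theorem cellFourierCoeff_re (k : Fin d → ℤ) (U : L2Cell d) :
    (cellFourierCoeff k U).re = inner ℝ (waveLp k 0) U := rfl

theorem cellFourierCoeff_im (k : Fin d → ℤ) (U : L2Cell d) :
    (cellFourierCoeff k U).im = inner ℝ (waveLp k (Real.pi / 2)) U := rfl

theorem integral_mul_eq_inner {α : Type*} [MeasurableSpace α] {μ : Measure α} {u v : α → ℝ}
    {U V : Lp ℝ 2 μ} (hu : u =ᵐ[μ] U) (hv : v =ᵐ[μ] V) : ∫ y, u y * v y ∂μ = inner ℝ U V := by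
  rw [L2.inner_def]
  refine integral_congr_ae ?_
  filter_upwards [hu, hv] with y hy hy'
  rw [hy, hy', RCLike.inner_apply', conj_trivial]

theorem inner_toLp_toLp {u v : (Fin d → ℝ) → ℝ} (hu : MemLp u 2 (cellMeasure d))
    (hv : MemLp v 2 (cellMeasure d)) :
    inner ℝ (hu.toLp u) (hv.toLp v) = ∫ y in cell d, u y * v y :=
  (integral_mul_eq_inner hu.coeFn_toLp.symm hv.coeFn_toLp.symm).symm

theorem cellFourierCoeff_eq_integral (k : Fin d → ℤ) (U : L2Cell d) :
    cellFourierCoeff k U =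
      ∫ y in cell d, (wave k 0 y + wave k (Real.pi / 2) y * Complex.I : ℂ) * U y := by
  have h_int (s : ℝ) : Integrable (fun y => wave k s y * U y) (cellMeasure d) :=
    (isTest_wave k s).memL2.2.integrable_mul (Lp.memLp U)
  have h_inner (s : ℝ) : inner ℝ (waveLp k s) U = ∫ y in cell d, wave k s y * U y := by
    rw [waveLp, ← inner_toLp_toLp _ (Lp.memLp U), Lp.toLp_coeFn]
  have h_split (y : Fin d → ℝ) :
      (wave k 0 y + wave k (Real.pi / 2) y * Complex.I : ℂ) * U y =
        ((wave k 0 y * U y : ℝ) : ℂ) + ((wave k (Real.pi / 2) y * U y : ℝ) : ℂ) * Complex.I := by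
    push_cast
    ring
  simp only [h_split]
  rw [integral_add (h_int _).ofReal ((h_int _).ofReal.mul_const _), integral_mul_const,
    integral_complex_ofReal, integral_complex_ofReal, ← h_inner, ← h_inner,
    ← cellFourierCoeff_re, ← cellFourierCoeff_im, Complex.re_add_im]

section Torus

attribute [local instance] instMeasureSpaceUnitAddCircle

/-- The section of the quotient map from the periodicity cell to the unit torus. -/
def torusSection (t : UnitAddTorus (Fin d)) : Fin d → ℝ :=
  (2 * Real.pi) • (UnitAddTorus.measurableEquivPiIoc (fun _ : Fin d => (0 : ℝ)) t).1

theorem measurableEmbedding_torusSection : MeasurableEmbedding (torusSection (d := d)) :=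
  (measurableEmbedding_const_smul₀ Real.two_pi_pos.ne').comp
    ((MeasurableEmbedding.subtype_coe (MeasurableSet.univ_pi' fun _ => measurableSet_Ioc)).comp
      (MeasurableEquiv.measurableEmbedding _))

theorem smul_preimage_pi_Ioc :
    ((2 * Real.pi) • · : (Fin d → ℝ) → Fin d → ℝ) ⁻¹'
      (Set.pi Set.univ fun _ => Set.Ioc 0 (2 * Real.pi)) =
      {x | ∀ i, x i ∈ Set.Ioc (0 : ℝ) (0 + 1)} := by
  ext x
  simp [Set.mem_pi, Real.pi_pos]

theorem measurePreserving_torusSection (d : ℕ) :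
    MeasurePreserving (torusSection (d := d)) volume
      (ENNReal.ofReal ((2 * Real.pi) ^ d)⁻¹ • cellMeasure d) := by
  have h_pos : (0 : ℝ) < ((2 * Real.pi) ^ d)⁻¹ := by positivity
  have h_torus := UnitAddTorus.measurePreserving_equivPiIoc (fun _ : Fin d => (0 : ℝ))
  have h_coe := measurePreserving_subtype_coe (μa := (volume : Measure (Fin d → ℝ)))
    (s := {x | ∀ i, x i ∈ Set.Ioc (0 : ℝ) (0 + 1)})
    (MeasurableSet.univ_pi' fun _ => measurableSet_Ioc)
  have h_smul : MeasurePreserving ((2 * Real.pi) • · : (Fin d → ℝ) → Fin d → ℝ) volume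
      (ENNReal.ofReal ((2 * Real.pi) ^ d)⁻¹ • volume) :=
    ⟨measurable_const_smul _, by
      rw [Measure.map_addHaar_smul _ Real.two_pi_pos.ne', Module.finrank_fin_fun,
        abs_of_pos h_pos]⟩
  have h_cell := h_smul.restrict_preimage
    (MeasurableSet.univ_pi fun _ : Fin d => measurableSet_Ioc (a := 0) (b := 2 * Real.pi))
  rw [smul_preimage_pi_Ioc, Measure.restrict_smul,
    ← Measure.restrict_congr_set (cell_ae_eq_Ioc d)] at h_cell
  exact h_cell.comp (h_coe.comp h_torus)

theorem integral_torusSection {E : Type*} [NormedAddCommGroup E] [NormedSpace ℝ E]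
    (g : (Fin d → ℝ) → E) :
    ∫ t, g (torusSection t) = ((2 * Real.pi) ^ d)⁻¹ • ∫ y in cell d, g y := by
  rw [(measurePreserving_torusSection d).integral_comp measurableEmbedding_torusSection,
    integral_smul_measure, ENNReal.toReal_ofReal (by positivity)]

theorem mFourier_torusSection (k : Fin d → ℤ) (t : UnitAddTorus (Fin d)) :
    UnitAddTorus.mFourier (-k) t =
      wave k 0 (torusSection t) + wave k (Real.pi / 2) (torusSection t) * Complex.I := by
  let x := (UnitAddTorus.measurableEquivPiIoc (fun _ => 0) t).1
  have ht : t = fun i => (x i : UnitAddCircle) :=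
    ((UnitAddTorus.measurableEquivPiIoc fun _ : Fin d => (0 : ℝ)).symm_apply_apply t).symm
  have h_exp : UnitAddTorus.mFourier (-k) t =
      Complex.exp (((-∑ i, k i * torusSection t i : ℝ) : ℂ) * Complex.I) := by
    rw [ht]
    simp only [UnitAddTorus.mFourier, ContinuousMap.coe_mk, fourier_coe_apply, ← Complex.exp_sum]
    rw [← ht, show torusSection t = (2 * Real.pi) • x from rfl]
    push_cast
    rw [← Finset.sum_neg_distrib, Finset.sum_mul]
    congr! 2 with i
    simp
    ring
  rw [h_exp, Complex.exp_mul_I, wave, wave, add_zero, Real.cos_add_pi_div_two,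
    ← Complex.ofReal_cos, ← Complex.ofReal_sin, Real.cos_neg, Real.sin_neg]

theorem mFourierCoeff_torusSection (k : Fin d → ℤ) (U : L2Cell d) :
    UnitAddTorus.mFourierCoeff (fun t => (U (torusSection t) : ℂ)) k =
      ((2 * Real.pi) ^ d)⁻¹ • cellFourierCoeff k U := by
  rw [cellFourierCoeff_eq_integral, ← integral_torusSection]
  simp only [UnitAddTorus.mFourierCoeff, mFourier_torusSection, smul_eq_mul]

theorem memLp_torusSection (U : L2Cell d) :
    MemLp (fun t : UnitAddTorus (Fin d) => (U (torusSection t) : ℂ)) 2 volume :=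
  (((Lp.memLp U).smul_measure ENNReal.ofReal_ne_top).comp_measurePreserving
    (measurePreserving_torusSection d)).ofReal

theorem hasSum_inner_cellFourierCoeff (U W : L2Cell d) :
    HasSum (fun k => inner ℝ (cellFourierCoeff k U) (cellFourierCoeff k W))
      ((2 * Real.pi) ^ d * inner ℝ U W) := by
  have h_coeff (V : L2Cell d) (k : Fin d → ℤ) :
      UnitAddTorus.mFourierCoeff ((memLp_torusSection V).toLp _) k =
        (((2 * Real.pi) ^ d)⁻¹ : ℝ) • cellFourierCoeff k V := by
    rw [← mFourierCoeff_torusSection]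
    exact integral_congr_ae (ae_eq_rfl.mul (memLp_torusSection V).coeFn_toLp)
  have h_inner : ∫ t, (starRingEnd ℂ) ((memLp_torusSection U).toLp _ t) *
      (memLp_torusSection W).toLp _ t = ((((2 * Real.pi) ^ d)⁻¹ * inner ℝ U W : ℝ) : ℂ) := by
    rw [L2.inner_def, ← smul_eq_mul, ← integral_torusSection, ← integral_complex_ofReal]
    refine integral_congr_ae ?_
    filter_upwards [(memLp_torusSection U).coeFn_toLp, (memLp_torusSection W).coeFn_toLp]
      with t hU hW
    rw [hU, hW, Complex.conj_ofReal, RCLike.inner_apply', conj_trivial, Complex.ofReal_mul]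
  have h_torus := UnitAddTorus.hasSum_prod_mFourierCoeff ((memLp_torusSection U).toLp _)
    ((memLp_torusSection W).toLp _)
  simp only [h_coeff, h_inner] at h_torus
  have h_value : (2 * Real.pi) ^ d * inner ℝ U W =
      ((2 * Real.pi) ^ d) ^ 2 * (((((2 * Real.pi) ^ d)⁻¹ * inner ℝ U W : ℝ) : ℂ)).re := by
    rw [Complex.ofReal_re]
    field_simp
  rw [h_value]
  refine ((Complex.hasSum_re h_torus).mul_left _).congr_fun fun k => ?_
  rw [Complex.inner, Complex.real_smul, Complex.real_smul, map_mul, Complex.conj_ofReal,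
    mul_mul_mul_comm, ← Complex.ofReal_mul, Complex.re_ofReal_mul]
  field_simp

end Torus

theorem hasSum_sq_cellFourierCoeff (U : L2Cell d) :
    HasSum (fun k => ‖cellFourierCoeff k U‖ ^ 2) ((2 * Real.pi) ^ d * ‖U‖ ^ 2) := by
  simpa only [real_inner_self_eq_norm_sq] using hasSum_inner_cellFourierCoeff U U

theorem sum_norm_sq_le_of_cellFourierCoeff {ι κ : Type*} [Fintype ι] [Fintype κ]
    {U : ι → L2Cell d} {W : κ → L2Cell d}
    (h : ∀ k, ∑ i, ‖cellFourierCoeff k (U i)‖ ^ 2 ≤ ∑ j, ‖cellFourierCoeff k (W j)‖ ^ 2) :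
    ∑ i, ‖U i‖ ^ 2 ≤ ∑ j, ‖W j‖ ^ 2 := by
  have h_sums := hasSum_le h (hasSum_sum fun i _ => hasSum_sq_cellFourierCoeff (U i))
    (hasSum_sum fun j _ => hasSum_sq_cellFourierCoeff (W j))
  simp only [← Finset.mul_sum] at h_sums
  exact le_of_mul_le_mul_left h_sums (by positivity)

theorem ext_cellFourierCoeff {U W : L2Cell d}
    (h : ∀ k, cellFourierCoeff k U = cellFourierCoeff k W) : U = W := by
  have h_le : ∑ _i : Unit, ‖U - W‖ ^ 2 ≤ ∑ _i : Empty, ‖(0 : L2Cell d)‖ ^ 2 :=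
    sum_norm_sq_le_of_cellFourierCoeff fun k => by simp [h k]
  simpa [sub_eq_zero] using h_le

theorem cellFourierCoeff_zero_toLp {u : (Fin d → ℝ) → ℝ} (hu : MemLp u 2 (cellMeasure d)) :
    cellFourierCoeff 0 (hu.toLp u) = ((∫ y in cell d, u y : ℝ) : ℂ) := by
  apply Complex.ext
  · rw [cellFourierCoeff_re, waveLp, inner_toLp_toLp]
    simp [wave]
  · rw [cellFourierCoeff_im, waveLp, inner_toLp_toLp]
    simp [wave]

/-- `G` is the weak partial derivative of `U` in the `m`-th direction, for classes in `L2Cell d`,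
expressed by their Fourier coefficients. -/
def HasWeakPartial (m : Fin d) (U G : L2Cell d) : Prop :=
  ∀ k, cellFourierCoeff k G = (k m : ℝ) • (Complex.I * cellFourierCoeff k U)

namespace HasWeakPartial

variable {m : Fin d} {U W G H : L2Cell d}

theorem unique (hG : HasWeakPartial m U G) (hH : HasWeakPartial m U H) : G = H :=
  ext_cellFourierCoeff fun k => (hG k).trans (hH k).symm

theorem add (h : HasWeakPartial m U G) (h' : HasWeakPartial m W H) :
    HasWeakPartial m (U + W) (G + H) := fun k => by
  rw [map_add, map_add, h k, h' k, mul_add, smul_add]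

theorem const_smul (c : ℝ) (h : HasWeakPartial m U G) : HasWeakPartial m (c • U) (c • G) :=
  fun k => by rw [map_smul, map_smul, h k, mul_smul_comm, smul_comm]

theorem cellFourierCoeff_zero (h : HasWeakPartial m U G) : cellFourierCoeff 0 G = 0 := by
  simp [h 0]

theorem norm_sq (h : HasWeakPartial m U G) (k : Fin d → ℤ) :
    ‖cellFourierCoeff k G‖ ^ 2 = (k m : ℝ) ^ 2 * ‖cellFourierCoeff k U‖ ^ 2 := by
  rw [h k, norm_smul, norm_mul, Complex.norm_I, one_mul, mul_pow, Real.norm_eq_abs, sq_abs]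

theorem inner_eq_neg (hU : HasWeakPartial m U G) (hW : HasWeakPartial m W H) :
    inner ℝ U H = - inner ℝ G W := by
  have h_mode (k : Fin d → ℤ) : inner ℝ (cellFourierCoeff k U) (cellFourierCoeff k H) =
      -inner ℝ (cellFourierCoeff k G) (cellFourierCoeff k W) := by
    rw [hU k, hW k]
    simp [Complex.inner]
    ring
  have h_UH := hasSum_inner_cellFourierCoeff U H
  simp only [h_mode] at h_UH
  have h := h_UH.unique (hasSum_inner_cellFourierCoeff G W).neg
  rw [← mul_neg] at h
  exact mul_left_cancel₀ (by positivity) h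

end HasWeakPartial

theorem IsWeakPartial.hasWeakPartial {m : Fin d} {u g : (Fin d → ℝ) → ℝ}
    (hu : MemLp u 2 (cellMeasure d)) (h : IsWeakPartial m u g) :
    HasWeakPartial m (hu.toLp u) (h.1.2.toLp g) := by
  have h_test (k : Fin d → ℤ) (s : ℝ) :
      k m * inner ℝ (waveLp k (s + Real.pi / 2)) (hu.toLp u) =
        -inner ℝ (waveLp k s) (h.1.2.toLp g) := by
    rw [waveLp, waveLp, inner_toLp_toLp, inner_toLp_toLp, ← integral_const_mul]
    simpa only [fderiv_wave, mul_comm, mul_assoc, mul_left_comm] using h.2 _ (isTest_wave k s)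
  intro k
  apply Complex.ext
  · have h_re := h_test k 0
    rw [zero_add] at h_re
    simp [cellFourierCoeff_re, cellFourierCoeff_im, h_re]
  · have h_neg : waveLp k (Real.pi / 2 + Real.pi / 2) = -waveLp k 0 := by
      have h_fun : wave k (Real.pi / 2 + Real.pi / 2) = -wave k 0 := by
        funext y
        simp [wave, Real.cos_add_pi]
      simp only [waveLp, h_fun]
      exact MemLp.toLp_neg _
    have h_im := h_test k (Real.pi / 2)
    rw [h_neg, inner_neg_left, mul_neg, neg_inj] at h_im
    simp [cellFourierCoeff_re, cellFourierCoeff_im, h_im]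

theorem HasWeakPartial.isWeakPartial {m : Fin d} {u g : (Fin d → ℝ) → ℝ}
    (hu : MemLp u 2 (cellMeasure d)) (hg : MemL2 g)
    (h : HasWeakPartial m (hu.toLp u) (hg.2.toLp g)) : IsWeakPartial m u g := by
  refine ⟨hg, fun φ hφ => ?_⟩
  rw [← inner_toLp_toLp hu (hφ.fderiv_apply _).memL2.2, ← inner_toLp_toLp hg.2 hφ.memL2.2]
  exact h.inner_eq_neg ((hφ.isWeakPartial m).hasWeakPartial hφ.memL2.2)

theorem isWeakPartial_weakPartial {m : Fin d} {u : (Fin d → ℝ) → ℝ}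
    (h : ∃ g, IsWeakPartial m u g) : IsWeakPartial m u (weakPartial m u) := by
  rw [weakPartial, dif_pos h]
  exact h.choose_spec

theorem isWeakPartial_congr {m : Fin d} {u u' g : (Fin d → ℝ) → ℝ} (h : u =ᵐ[cellMeasure d] u') :
    IsWeakPartial m u g ↔ IsWeakPartial m u' g := by
  have h_integral (φ : (Fin d → ℝ) → ℝ) : ∫ y in cell d, u y * fderiv ℝ φ y (Pi.single m 1) =
      ∫ y in cell d, u' y * fderiv ℝ φ y (Pi.single m 1) :=
    integral_congr_ae (h.mul ae_eq_rfl)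
  simp only [IsWeakPartial, h_integral]

theorem MemH1.isWeakPartial {u : (Fin d → ℝ) → ℝ} (hu : MemH1 u) (m : Fin d) :
    IsWeakPartial m u (weakPartial m u) :=
  isWeakPartial_weakPartial (hu.2 m)

theorem MemH2.memH1 {u : (Fin d → ℝ) → ℝ} (hu : MemH2 u) : MemH1 u :=
  ⟨hu.1, fun m => (hu.2 m).imp fun _ h => h.1⟩

theorem MemH2.memH1_weakPartial {u : (Fin d → ℝ) → ℝ} (hu : MemH2 u) (m : Fin d) :
    MemH1 (weakPartial m u) := by
  obtain ⟨g, hg, hg1⟩ := hu.2 m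
  have h_partial := hu.memH1.isWeakPartial m
  have h_ae : g =ᵐ[cellMeasure d] weakPartial m u :=
    (MemLp.toLp_eq_toLp_iff _ _).1
      ((hg.hasWeakPartial hu.1.2).unique (h_partial.hasWeakPartial hu.1.2))
  exact ⟨h_partial.1, fun n => (hg1.2 n).imp fun _ h => (isWeakPartial_congr h_ae).1 h⟩

theorem isClosed_hasWeakPartial {X : Type*} [TopologicalSpace X] {U G : X → L2Cell d}
    (hU : Continuous U) (hG : Continuous G) (m : Fin d) :
    IsClosed {x | HasWeakPartial m (U x) (G x)} := by
  simp only [HasWeakPartial, Set.ofPred_forall]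
  exact isClosed_iInter fun k => isClosed_eq (by fun_prop) (by fun_prop)

theorem hasWeakPartial_zero (m : Fin d) : HasWeakPartial m (0 : L2Cell d) 0 := fun k => by simp

/-- Square integrable vector fields on the cell. -/
abbrev L2Field (d : ℕ) : Type := PiLp 2 (fun _ : Fin d => L2Cell d)

/-- The mean-zero part of `H¹_♯(Y)`, as the space of pairs of a function and its gradient. -/
def sobolev1 (d : ℕ) : Submodule ℝ (WithLp 2 (L2Cell d × L2Field d)) where
  carrier := {x | cellFourierCoeff 0 x.fst = 0 ∧ ∀ m, HasWeakPartial m x.fst (x.snd m)}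
  zero_mem' := ⟨map_zero _, hasWeakPartial_zero⟩
  add_mem' := fun hx hy =>
    ⟨by rw [WithLp.add_fst, map_add, hx.1, hy.1, add_zero], fun m => (hx.2 m).add (hy.2 m)⟩
  smul_mem' := fun c x hx =>
    ⟨by rw [WithLp.smul_fst, map_smul, hx.1, smul_zero], fun m => (hx.2 m).const_smul c⟩

theorem isClosed_sobolev1 (d : ℕ) :
    IsClosed (sobolev1 d : Set (WithLp 2 (L2Cell d × L2Field d))) := by
  change IsClosed {x : WithLp 2 (L2Cell d × L2Field d) |
    cellFourierCoeff 0 x.fst = 0 ∧ ∀ m, HasWeakPartial m x.fst (x.snd m)}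
  simp only [Set.ofPred_and, Set.ofPred_forall]
  exact (isClosed_eq (by fun_prop) continuous_const).inter
    (isClosed_iInter fun m => isClosed_hasWeakPartial (by fun_prop) (by fun_prop) m)

/-- The Hilbert space of elements of `sobolev1 d`, kept apart from the coerced submodule so that
instance search does not unfold it. -/
def Sobolev1 (d : ℕ) : Type := sobolev1 d

instance (d : ℕ) : NormedAddCommGroup (Sobolev1 d) :=
  inferInstanceAs (NormedAddCommGroup (sobolev1 d))

instance (d : ℕ) : InnerProductSpace ℝ (Sobolev1 d) :=
  inferInstanceAs (InnerProductSpace ℝ (sobolev1 d))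

instance (d : ℕ) : CompleteSpace (Sobolev1 d) := (isClosed_sobolev1 d).completeSpace_coe

namespace Sobolev1

/-- The function underlying an element of `Sobolev1 d`. -/
def value (d : ℕ) : Sobolev1 d →L[ℝ] L2Cell d := WithLp.fstL 2 ℝ _ _ ∘L (sobolev1 d).subtypeL

/-- The gradient on `Sobolev1 d`. -/
def grad (d : ℕ) : Sobolev1 d →L[ℝ] L2Field d := WithLp.sndL 2 ℝ _ _ ∘L (sobolev1 d).subtypeL

theorem cellFourierCoeff_zero_value (x : Sobolev1 d) : cellFourierCoeff 0 (value d x) = 0 := x.2.1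

theorem hasWeakPartial_grad (x : Sobolev1 d) (m : Fin d) :
    HasWeakPartial m (value d x) (grad d x m) := x.2.2 m

theorem ext_value {x y : Sobolev1 d} (h : value d x = value d y) : x = y := by
  have h_grad : grad d x = grad d y := PiLp.ext fun m =>
    (hasWeakPartial_grad x m).unique (h ▸ hasWeakPartial_grad y m)
  exact Subtype.ext (WithLp.ofLp_injective 2 (Prod.ext h h_grad))

theorem norm_sq_value_le (x : Sobolev1 d) : ‖value d x‖ ^ 2 ≤ ‖grad d x‖ ^ 2 := by
  have h_mode (k : Fin d → ℤ) : ∑ _i : Unit, ‖cellFourierCoeff k (value d x)‖ ^ 2 ≤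
      ∑ m, ‖cellFourierCoeff k (grad d x m)‖ ^ 2 := by
    simp only [Finset.univ_unique, Finset.sum_singleton, (hasWeakPartial_grad x _).norm_sq]
    rcases eq_or_ne k 0 with rfl | hk
    · simp [cellFourierCoeff_zero_value]
    · obtain ⟨m, hm⟩ := Function.ne_iff.1 hk
      have h_one : (1 : ℝ) ≤ (k m : ℝ) ^ 2 := by
        exact_mod_cast (one_le_sq_iff_one_le_abs _).2 (Int.one_le_abs hm)
      refine le_trans (le_mul_of_one_le_left (by positivity) h_one) ?_
      exact Finset.single_le_sum
        (f := fun m => (k m : ℝ) ^ 2 * ‖cellFourierCoeff k (value d x)‖ ^ 2)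
        (fun _ _ => by positivity) (Finset.mem_univ m)
  simpa [PiLp.norm_sq_eq_of_L2] using sum_norm_sq_le_of_cellFourierCoeff h_mode

theorem norm_sq_le (x : Sobolev1 d) : ‖x‖ ^ 2 ≤ 2 * ‖grad d x‖ ^ 2 := by
  have h_norm : ‖x‖ ^ 2 = ‖value d x‖ ^ 2 + ‖grad d x‖ ^ 2 :=
    WithLp.prod_norm_sq_eq_of_L2 x.1
  linarith [norm_sq_value_le x]

end Sobolev1

/-- The mean-zero part of `H²_♯(Y)`, as the space of functions in `H¹_♯(Y)` together with their
partial derivatives, again in `H¹_♯(Y)`. -/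
def sobolev2 (d : ℕ) :
    Submodule ℝ (WithLp 2 (Sobolev1 d × PiLp 2 fun _ : Fin d => Sobolev1 d)) where
  carrier := {x | ∀ m, Sobolev1.value d (x.snd m) = Sobolev1.grad d x.fst m}
  zero_mem' := fun m => by simp
  add_mem' := fun hx hy m => by simp [hx m, hy m]
  smul_mem' := fun c x hx m => by simp [hx m]

theorem isClosed_sobolev2 (d : ℕ) : IsClosed
    (sobolev2 d : Set (WithLp 2 (Sobolev1 d × PiLp 2 fun _ : Fin d => Sobolev1 d))) := by
  change IsClosed {x : WithLp 2 (Sobolev1 d × PiLp 2 fun _ : Fin d => Sobolev1 d) |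
    ∀ m, Sobolev1.value d (x.snd m) = Sobolev1.grad d x.fst m}
  simp only [Set.ofPred_forall]
  exact isClosed_iInter fun m => isClosed_eq (by fun_prop) (by fun_prop)

/-- The Hilbert space of elements of `sobolev2 d`, kept apart from the coerced submodule as
`Sobolev1 d` is. -/
def Sobolev2 (d : ℕ) : Type := sobolev2 d

instance (d : ℕ) : NormedAddCommGroup (Sobolev2 d) :=
  inferInstanceAs (NormedAddCommGroup (sobolev2 d))

instance (d : ℕ) : InnerProductSpace ℝ (Sobolev2 d) :=
  inferInstanceAs (InnerProductSpace ℝ (sobolev2 d))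

instance (d : ℕ) : CompleteSpace (Sobolev2 d) := (isClosed_sobolev2 d).completeSpace_coe

namespace Sobolev2

/-- The inclusion of `H²_♯(Y)` into `H¹_♯(Y)`. -/
def toSobolev1 (d : ℕ) : Sobolev2 d →L[ℝ] Sobolev1 d :=
  WithLp.fstL 2 ℝ _ _ ∘L (sobolev2 d).subtypeL

/-- The partial derivative in the `m`-th direction as a map from `H²_♯(Y)` to `H¹_♯(Y)`. -/
def partialDeriv (m : Fin d) : Sobolev2 d →L[ℝ] Sobolev1 d :=
  PiLp.proj 2 (fun _ : Fin d => Sobolev1 d) m ∘L WithLp.sndL 2 ℝ _ _ ∘L (sobolev2 d).subtypeL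

/-- The function underlying an element of `Sobolev2 d`. -/
def value (d : ℕ) : Sobolev2 d →L[ℝ] L2Cell d := Sobolev1.value d ∘L toSobolev1 d

/-- The gradient on `Sobolev2 d`. -/
def grad (d : ℕ) : Sobolev2 d →L[ℝ] L2Field d := Sobolev1.grad d ∘L toSobolev1 d

/-- The Laplacian on `Sobolev2 d`. -/
def laplacian (d : ℕ) : Sobolev2 d →L[ℝ] L2Cell d :=
  ∑ m, PiLp.proj 2 (fun _ : Fin d => L2Cell d) m ∘L Sobolev1.grad d ∘L partialDeriv m

theorem laplacian_apply (x : Sobolev2 d) :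
    laplacian d x = ∑ m, Sobolev1.grad d (partialDeriv m x) m := by
  simp [laplacian]

theorem value_partialDeriv (x : Sobolev2 d) (m : Fin d) :
    Sobolev1.value d (partialDeriv m x) = grad d x m := x.2 m

theorem hasWeakPartial_grad (x : Sobolev2 d) (m : Fin d) :
    HasWeakPartial m (value d x) (grad d x m) :=
  Sobolev1.hasWeakPartial_grad (toSobolev1 d x) m

theorem hasWeakPartial_grad_partialDeriv (x : Sobolev2 d) (m n : Fin d) :
    HasWeakPartial n (grad d x m) (Sobolev1.grad d (partialDeriv m x) n) :=
  value_partialDeriv x m ▸ Sobolev1.hasWeakPartial_grad (partialDeriv m x) n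

theorem ext_value {x y : Sobolev2 d} (h : value d x = value d y) :
    x = y := by
  have h_fst : toSobolev1 d x = toSobolev1 d y := Sobolev1.ext_value h
  have h_snd (m : Fin d) : partialDeriv m x = partialDeriv m y := Sobolev1.ext_value <| by
    rw [value_partialDeriv, value_partialDeriv, grad, ContinuousLinearMap.comp_apply,
      ContinuousLinearMap.comp_apply, h_fst]
  exact Subtype.ext (WithLp.ofLp_injective 2 (Prod.ext h_fst (PiLp.ext h_snd)))

theorem cellFourierCoeff_laplacian (x : Sobolev2 d) (k : Fin d → ℤ) :
    cellFourierCoeff k (laplacian d x) =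
      -(∑ m, (k m : ℝ) ^ 2) • cellFourierCoeff k (value d x) := by
  have h_second (m : Fin d) : cellFourierCoeff k (Sobolev1.grad d (partialDeriv m x) m) =
      -((k m : ℝ) ^ 2) • cellFourierCoeff k (value d x) := by
    rw [hasWeakPartial_grad_partialDeriv x m m k, hasWeakPartial_grad x m k]
    simp only [Complex.real_smul, Complex.ofReal_pow, Complex.ofReal_neg]
    linear_combination (k m : ℂ) ^ 2 * cellFourierCoeff k (value d x) * Complex.I_sq
  rw [laplacian_apply, map_sum, Finset.sum_congr rfl fun m _ => h_second m, ← Finset.sum_smul,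
    Finset.sum_neg_distrib]

theorem sum_norm_sq_grad_partialDeriv_le (x : Sobolev2 d) :
    ∑ m, ‖Sobolev1.grad d (partialDeriv m x)‖ ^ 2 ≤ ‖laplacian d x‖ ^ 2 := by
  have h_mode (k : Fin d → ℤ) :
      ∑ i : Fin d × Fin d, ‖cellFourierCoeff k (Sobolev1.grad d (partialDeriv i.1 x) i.2)‖ ^ 2 ≤
        ∑ _i : Unit, ‖cellFourierCoeff k (laplacian d x)‖ ^ 2 := by
    have h_entry (m n : Fin d) :
        ‖cellFourierCoeff k (Sobolev1.grad d (partialDeriv m x) n)‖ ^ 2 =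
          (k n : ℝ) ^ 2 * ((k m : ℝ) ^ 2 * ‖cellFourierCoeff k (value d x)‖ ^ 2) := by
      rw [(hasWeakPartial_grad_partialDeriv x m n).norm_sq, (hasWeakPartial_grad x m).norm_sq]
    simp only [Fintype.sum_prod_type, h_entry, Finset.univ_unique, Finset.sum_singleton,
      cellFourierCoeff_laplacian, norm_smul, mul_pow, norm_neg, Real.norm_eq_abs, sq_abs]
    simp only [← Finset.sum_mul, ← Finset.mul_sum, sq (∑ m, (k m : ℝ) ^ 2), mul_assoc, le_refl]
  simpa [PiLp.norm_sq_eq_of_L2, Fintype.sum_prod_type] using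
    sum_norm_sq_le_of_cellFourierCoeff h_mode

theorem norm_grad_le (x : Sobolev2 d) : ‖grad d x‖ ≤ ‖laplacian d x‖ := by
  rw [← sq_le_sq₀ (norm_nonneg _) (norm_nonneg _)]
  refine le_trans ?_ (sum_norm_sq_grad_partialDeriv_le x)
  rw [PiLp.norm_sq_eq_of_L2]
  refine Finset.sum_le_sum fun m _ => ?_
  rw [← value_partialDeriv]
  exact Sobolev1.norm_sq_value_le _

theorem norm_sq_le (x : Sobolev2 d) : ‖x‖ ^ 2 ≤ 4 * ‖laplacian d x‖ ^ 2 := by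
  have h_norm : ‖x‖ ^ 2 = ‖toSobolev1 d x‖ ^ 2 + ∑ m, ‖partialDeriv m x‖ ^ 2 := by
    have h := WithLp.prod_norm_sq_eq_of_L2 x.1
    rwa [PiLp.norm_sq_eq_of_L2] at h
  have h_partials : ∑ m, ‖partialDeriv m x‖ ^ 2 ≤ 2 * ‖laplacian d x‖ ^ 2 :=
    calc ∑ m, ‖partialDeriv m x‖ ^ 2
        ≤ ∑ m, 2 * ‖Sobolev1.grad d (partialDeriv m x)‖ ^ 2 :=
          Finset.sum_le_sum fun m _ => Sobolev1.norm_sq_le _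
      _ ≤ 2 * ‖laplacian d x‖ ^ 2 := by
          rw [← Finset.mul_sum]
          gcongr
          exact sum_norm_sq_grad_partialDeriv_le x
  have h_toSobolev1 : ‖toSobolev1 d x‖ ^ 2 ≤ 2 * ‖grad d x‖ ^ 2 := Sobolev1.norm_sq_le _
  linarith [pow_le_pow_left₀ (norm_nonneg _) (norm_grad_le x) 2]

end Sobolev2

/-- The class `U` minus its mean. -/
def center (U : L2Cell d) : L2Cell d :=
  U - (((2 * Real.pi) ^ d)⁻¹ * inner ℝ (waveLp 0 0) U) • waveLp 0 0

theorem cellFourierCoeff_center (U : L2Cell d) : cellFourierCoeff 0 (center U) = 0 := by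
  have h_one : cellFourierCoeff 0 (waveLp (d := d) 0 0) = (((2 * Real.pi) ^ d : ℝ) : ℂ) := by
    rw [waveLp, cellFourierCoeff_zero_toLp]
    simp [wave, volume_real_cell]
  have h_im : (cellFourierCoeff 0 U).im = 0 := by
    rw [← Lp.toLp_coeFn U (Lp.memLp U), cellFourierCoeff_zero_toLp, Complex.ofReal_im]
  rw [center, map_sub, map_smul, h_one, sub_eq_zero]
  apply Complex.ext
  · rw [← cellFourierCoeff_re, Complex.real_smul, ← Complex.ofReal_mul, Complex.ofReal_re]
    field_simp
  · rw [h_im, Complex.real_smul, ← Complex.ofReal_mul, Complex.ofReal_im]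

theorem center_eq_self {U : L2Cell d} (hU : cellFourierCoeff 0 U = 0) : center U = U := by
  rw [center, ← cellFourierCoeff_re, hU, Complex.zero_re, mul_zero, zero_smul, sub_zero]

theorem IsTest.hasWeakPartial {φ : (Fin d → ℝ) → ℝ} (hφ : IsTest φ) (m : Fin d) :
    HasWeakPartial m (hφ.memL2.2.toLp φ) ((hφ.fderiv_apply (Pi.single m 1)).memL2.2.toLp _) :=
  (hφ.isWeakPartial m).hasWeakPartial hφ.memL2.2

theorem HasWeakPartial.center {m : Fin d} {U G : L2Cell d} (h : HasWeakPartial m U G) :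
    HasWeakPartial m (center U) G := by
  have h_const : HasWeakPartial m (waveLp 0 0) 0 := by
    have h := (isTest_wave 0 0).hasWeakPartial m
    simp only [fderiv_wave, Pi.zero_apply, Int.cast_zero, zero_mul] at h
    exact h
  have := h.add (h_const.const_smul (-(((2 * Real.pi) ^ d)⁻¹ * inner ℝ (waveLp 0 0) U)))
  rwa [smul_zero, add_zero, neg_smul, ← sub_eq_add_neg] at this

namespace MemH1

variable {u : (Fin d → ℝ) → ℝ}

theorem hasWeakPartial (hu : MemH1 u) (m : Fin d) :
    HasWeakPartial m (hu.1.2.toLp u) ((hu.isWeakPartial m).1.2.toLp _) :=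
  (hu.isWeakPartial m).hasWeakPartial hu.1.2

/-- The element of `Sobolev1 d` given by a function of `H¹_♯(Y)` after subtraction of its mean. -/
def toSobolev1 (hu : MemH1 u) : Sobolev1 d :=
  ⟨WithLp.toLp 2 (center (hu.1.2.toLp u),
      WithLp.toLp 2 fun m => (hu.isWeakPartial m).1.2.toLp (weakPartial m u)),
    cellFourierCoeff_center _, fun m => (hu.hasWeakPartial m).center⟩

theorem value_toSobolev1 (hu : MemH1 u) :
    Sobolev1.value d hu.toSobolev1 = center (hu.1.2.toLp u) := rfl

end MemH1

namespace MemH2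

variable {u : (Fin d → ℝ) → ℝ}

/-- The element of `Sobolev2 d` given by a function of `H²_♯(Y)` after subtraction of its mean. -/
def toSobolev2 (hu : MemH2 u) : Sobolev2 d :=
  ⟨WithLp.toLp 2 (hu.memH1.toSobolev1,
      WithLp.toLp 2 fun m => (hu.memH1_weakPartial m).toSobolev1),
    fun m => center_eq_self (hu.memH1.hasWeakPartial m).cellFourierCoeff_zero⟩

theorem grad_toSobolev2 (hu : MemH2 u) :
    Sobolev2.grad d hu.toSobolev2 = Sobolev1.grad d hu.memH1.toSobolev1 := rfl

theorem laplacian_toSobolev2_ae_eq (hu : MemH2 u) :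
    Sobolev2.laplacian d hu.toSobolev2 =ᵐ[cellMeasure d] weakLaplacian u := by
  have h_second (m : Fin d) : Sobolev1.grad d (hu.memH1_weakPartial m).toSobolev1 m
      =ᵐ[cellMeasure d] weakPartial m (weakPartial m u) :=
    MemLp.coeFn_toLp ((hu.memH1_weakPartial m).isWeakPartial m).1.2
  rw [Sobolev2.laplacian_apply]
  filter_upwards [Lp.coeFn_finsetSum Finset.univ
      fun m => Sobolev1.grad d (Sobolev2.partialDeriv m hu.toSobolev2) m,
    ae_all_iff.2 h_second] with y hy hy'
  rw [hy, Finset.sum_apply, weakLaplacian]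
  exact Finset.sum_congr rfl fun m _ => hy' m

end MemH2

/-- The periodic function equal to a given representative of `U` on the periodicity cell. -/
def periodize (U : L2Cell d) (y : Fin d → ℝ) : ℝ := U (reduce y)

theorem memL2_periodize (U : L2Cell d) : MemL2 (periodize U) := memL2_comp_reduce (Lp.memLp U)

theorem toLp_periodize (U : L2Cell d) : (memL2_periodize U).2.toLp _ = U :=
  Lp.ext ((MemLp.coeFn_toLp _).trans (comp_reduce_ae_eq U))

theorem average_periodize {U : L2Cell d} (hU : cellFourierCoeff 0 U = 0) :
    ⨍ y in cell d, periodize U y = 0 := by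
  rw [← toLp_periodize U, cellFourierCoeff_zero_toLp] at hU
  exact average_cell_eq_zero.2 (Complex.ofReal_eq_zero.1 hU)

theorem HasWeakPartial.isWeakPartial_periodize {m : Fin d} {U G : L2Cell d}
    (h : HasWeakPartial m U G) : IsWeakPartial m (periodize U) (periodize G) :=
  HasWeakPartial.isWeakPartial (memL2_periodize U).2 (memL2_periodize G) <| by
    rwa [toLp_periodize, toLp_periodize]

theorem memH1_periodize (x : Sobolev1 d) : MemH1 (periodize (Sobolev1.value d x)) :=
  ⟨memL2_periodize _, fun m => ⟨_, (Sobolev1.hasWeakPartial_grad x m).isWeakPartial_periodize⟩⟩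

theorem toSobolev1_periodize (x : Sobolev1 d) : (memH1_periodize x).toSobolev1 = x :=
  Sobolev1.ext_value <| by
    rw [MemH1.value_toSobolev1, toLp_periodize,
      center_eq_self (Sobolev1.cellFourierCoeff_zero_value x)]

theorem memH2_periodize (x : Sobolev2 d) : MemH2 (periodize (Sobolev2.value d x)) :=
  ⟨memL2_periodize _, fun m =>
    ⟨_, (Sobolev2.hasWeakPartial_grad x m).isWeakPartial_periodize,
      Sobolev2.value_partialDeriv x m ▸ memH1_periodize (Sobolev2.partialDeriv m x)⟩⟩

theorem toSobolev2_periodize (x : Sobolev2 d) : (memH2_periodize x).toSobolev2 = x :=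
  Sobolev2.ext_value <|
    congrArg (Sobolev1.value d) (toSobolev1_periodize (Sobolev2.toSobolev1 d x))

theorem MemH1.ae_eq_of_toSobolev1_eq {u v : (Fin d → ℝ) → ℝ} (hu : MemH1 u) (hv : MemH1 v)
    (hu0 : ⨍ y in cell d, u y = 0) (hv0 : ⨍ y in cell d, v y = 0)
    (h : hu.toSobolev1 = hv.toSobolev1) : u =ᵐ[volume] v := by
  have h_value {w : (Fin d → ℝ) → ℝ} (hw : MemH1 w) (hw0 : ⨍ y in cell d, w y = 0) :
      Sobolev1.value d hw.toSobolev1 = hw.1.2.toLp w :=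
    center_eq_self (by
      rw [cellFourierCoeff_zero_toLp, average_cell_eq_zero.1 hw0, Complex.ofReal_zero])
  have h_toLp : hu.1.2.toLp u = hv.1.2.toLp v := by
    rw [← h_value hu hu0, ← h_value hv hv0, h]
  exact hu.1.1.ae_eq hv.1.1 ((MemLp.toLp_eq_toLp_iff _ _).1 h_toLp)

theorem sum_smul_cellFourierCoeff_eq_zero {p : L2Field d}
    (hp : ∀ y : Sobolev2 d, inner ℝ p (Sobolev2.grad d y) = 0) (k : Fin d → ℤ) :
    ∑ m, (k m : ℝ) • cellFourierCoeff k (p m) = 0 := by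
  have h_wave (s : ℝ) : ∑ m, (k m : ℝ) * inner ℝ (waveLp k (s + Real.pi / 2)) (p m) = 0 := by
    rw [← hp (isTest_wave k s).memH2.toSobolev2, PiLp.inner_apply]
    refine Finset.sum_congr rfl fun m _ => ?_
    have h_grad : Sobolev2.grad d (isTest_wave k s).memH2.toSobolev2 m =
        (k m : ℝ) • waveLp k (s + Real.pi / 2) := by
      refine ((isTest_wave k s).memH1.hasWeakPartial m).unique ?_
      have h := (isTest_wave k s).hasWeakPartial m
      simp only [fderiv_wave] at h
      exact h
    rw [h_grad, inner_smul_right, real_inner_comm]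
  apply Complex.ext
  · simpa [cellFourierCoeff_re] using h_wave (-(Real.pi / 2))
  · simpa [cellFourierCoeff_im] using h_wave 0

theorem inner_grad_eq_zero {p : L2Field d}
    (hp : ∀ y : Sobolev2 d, inner ℝ p (Sobolev2.grad d y) = 0) (x : Sobolev1 d) :
    inner ℝ p (Sobolev1.grad d x) = 0 := by
  have h_mode (k : Fin d → ℤ) :
      ∑ m, inner ℝ (cellFourierCoeff k (p m)) (cellFourierCoeff k (Sobolev1.grad d x m)) = 0 :=
    calc ∑ m, inner ℝ (cellFourierCoeff k (p m)) (cellFourierCoeff k (Sobolev1.grad d x m))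
        = inner ℝ (∑ m, (k m : ℝ) • cellFourierCoeff k (p m))
            (Complex.I * cellFourierCoeff k (Sobolev1.value d x)) := by
          simp only [Sobolev1.hasWeakPartial_grad x _ k, sum_inner, inner_smul_right,
            real_inner_smul_left]
      _ = 0 := by rw [sum_smul_cellFourierCoeff_eq_zero hp, inner_zero_left]
  have h_sum := hasSum_sum (s := Finset.univ) fun m _ =>
    hasSum_inner_cellFourierCoeff (p m) (Sobolev1.grad d x m)
  simp only [h_mode, ← Finset.mul_sum, ← PiLp.inner_apply] at h_sum
  exact (mul_eq_zero_iff_left (by positivity)).1 (h_sum.unique hasSum_zero)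

theorem grad_mem_closure_range (x : Sobolev1 d) :
    Sobolev1.grad d x ∈ closure (Set.range (Sobolev2.grad d)) := by
  have h_mem : Sobolev1.grad d x ∈ (LinearMap.range (Sobolev2.grad d).toLinearMap)ᗮᗮ := by
    rw [Submodule.mem_orthogonal]
    intro p hp
    refine inner_grad_eq_zero (fun y => ?_) x
    rw [real_inner_comm]
    exact hp _ ⟨y, rfl⟩
  rwa [Submodule.orthogonal_orthogonal_eq_closure, ← SetLike.mem_coe,
    Submodule.topologicalClosure_coe] at h_mem

section Variational

variable {V K X : Type*} [NormedAddCommGroup V] [InnerProductSpace ℝ V]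
  [NormedAddCommGroup K] [InnerProductSpace ℝ K] [NormedAddCommGroup X] [InnerProductSpace ℝ X]
  {D : V →L[ℝ] X} {T : V →L[ℝ] K} {L : K →L[ℝ] K} {e : K} {ρ θ : ℝ}

/-- The weak form of the equation `ρ² D*D x + T* L (e + T x) = 0`. -/
def IsWeakSolution (D : V →L[ℝ] X) (T : V →L[ℝ] K) (L : K →L[ℝ] K) (e : K) (ρ : ℝ) (x : V) :
    Prop :=
  ∀ v, ρ ^ 2 * inner ℝ (D x) (D v) + inner ℝ (L (e + T x)) (T v) = 0

theorem existsUnique_of_isCoercive [CompleteSpace V] {B : V →L[ℝ] V →L[ℝ] ℝ}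
    (hB : IsCoercive B) (f : V →L[ℝ] ℝ) : ∃! x, ∀ v, B x v = f v := by
  refine ⟨hB.continuousLinearEquivOfBilin.symm ((InnerProductSpace.toDual ℝ V).symm f),
    fun v => ?_, fun z hz => ?_⟩
  · rw [← hB.continuousLinearEquivOfBilin_apply, ContinuousLinearEquiv.apply_symm_apply,
      InnerProductSpace.toDual_symm_apply]
  · rw [ContinuousLinearEquiv.eq_symm_apply]
    refine (hB.unique_continuousLinearEquivOfBilin fun w => ?_).symm
    rw [InnerProductSpace.toDual_symm_apply, hz]

theorem existsUnique_isWeakSolution [CompleteSpace V] (e : K) {c : ℝ} (hc : 0 < c)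
    (h_coercive : ∀ x, c * ‖x‖ ^ 2 ≤ ρ ^ 2 * ‖D x‖ ^ 2 + inner ℝ (L (T x)) (T x)) :
    ∃! x, IsWeakSolution D T L e ρ x := by
  let innerX : X →L[ℝ] X →L[ℝ] ℝ := isBoundedBilinearMap_inner.toContinuousLinearMap
  let innerK : K →L[ℝ] K →L[ℝ] ℝ := isBoundedBilinearMap_inner.toContinuousLinearMap
  let B : V →L[ℝ] V →L[ℝ] ℝ := ρ ^ 2 • innerX.bilinearComp D D + innerK.bilinearComp (L ∘L T) T
  have h_apply (x v : V) :
      B x v = ρ ^ 2 * inner ℝ (D x) (D v) + inner ℝ (L (T x)) (T v) := rfl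
  have hB : IsCoercive B := ⟨c, hc, fun x => by
    simpa only [h_apply, real_inner_self_eq_norm_sq, mul_assoc, ← sq] using h_coercive x⟩
  have h_iff (x : V) :
      IsWeakSolution D T L e ρ x ↔ ∀ v, B x v = (-(innerSL ℝ (L e) ∘L T)) v := by
    refine forall_congr' fun v => ?_
    rw [h_apply, neg_apply, ContinuousLinearMap.comp_apply, innerSL_apply_apply, map_add,
      inner_add_left, ← add_eq_zero_iff_eq_neg]
    ring_nf
  simpa only [h_iff] using existsUnique_of_isCoercive hB _

theorem le_add_of_mul_sq_le {α β γ t : ℝ} (hα : 0 < α) (hβ : 0 ≤ β) (hγ : 0 ≤ γ)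
    (h : α * t ^ 2 ≤ β * t + γ ^ 2) : t ≤ β / α + γ / √α := by
  have h_sqrt : 0 < √α := Real.sqrt_pos.2 hα
  by_contra! h_lt
  have h_γ : γ < √α * t := by
    rw [← div_lt_iff₀' h_sqrt]
    exact (le_add_of_nonneg_left (by positivity)).trans_lt h_lt
  have h_β : β + √α * γ < α * t := by
    have h_mul := mul_lt_mul_of_pos_left h_lt hα
    rwa [mul_add, mul_div_cancel₀ _ hα.ne', mul_div_left_comm, Real.div_sqrt, mul_comm γ] at h_mul
  have ht : 0 < t := pos_of_mul_pos_right (hγ.trans_lt h_γ) h_sqrt.le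
  have h_sq : α * t ^ 2 ≤ β * t + (√α * t) * γ :=
    h.trans (by rw [sq γ]; gcongr)
  nlinarith [mul_lt_mul_of_pos_right h_β ht]

/-- A Céa-type estimate: `p` need not be attained by `T`, so `T z` is an approximation of it. -/
theorem IsWeakSolution.norm_map_sub_le {α : ℝ} (hα : 0 < α)
    (hL : ∀ q, α * ‖q‖ ^ 2 ≤ inner ℝ (L q) q) (hρ : ρ ≠ 0) {x z : V} {p : K}
    (hx : IsWeakSolution D T L e ρ x)
    (hz : ∀ v, θ ^ 2 * inner ℝ (D z) (D v) + inner ℝ (L (e + p)) (T v) = 0) :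
    ‖T x - T z‖ ≤ ‖L‖ * ‖T z - p‖ / α + |θ ^ 2 / ρ - ρ| * ‖D z‖ / 2 / √α := by
  refine le_add_of_mul_sq_le hα (by positivity) (by positivity) ?_
  have h_energy : ρ ^ 2 * ‖D x - D z‖ ^ 2 + inner ℝ (L (T x - T z)) (T x - T z) =
      (θ ^ 2 - ρ ^ 2) * inner ℝ (D z) (D x - D z) - inner ℝ (L (T z - p)) (T x - T z) := by
    have h_x := hx (x - z)
    have h_z := hz (x - z)
    rw [← real_inner_self_eq_norm_sq]
    simp only [map_sub, map_add, inner_sub_left, inner_add_left] at h_x h_z ⊢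
    linear_combination h_x - h_z
  have h_load : -inner ℝ (L (T z - p)) (T x - T z) ≤ ‖L‖ * ‖T z - p‖ * ‖T x - T z‖ :=
    (neg_le_abs _).trans <| (abs_real_inner_le_norm _ _).trans <|
      mul_le_mul_of_nonneg_right (L.le_opNorm _) (norm_nonneg _)
  have h_shift : (θ ^ 2 - ρ ^ 2) * inner ℝ (D z) (D x - D z) ≤
      ρ ^ 2 * ‖D x - D z‖ ^ 2 + (|θ ^ 2 / ρ - ρ| * ‖D z‖ / 2) ^ 2 :=
    calc (θ ^ 2 - ρ ^ 2) * inner ℝ (D z) (D x - D z)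
        ≤ |(θ ^ 2 / ρ - ρ) * ρ * inner ℝ (D z) (D x - D z)| := by
          rw [sub_mul (θ ^ 2 / ρ), div_mul_cancel₀ _ hρ, ← sq]
          exact le_abs_self _
      _ ≤ |θ ^ 2 / ρ - ρ| * |ρ| * (‖D z‖ * ‖D x - D z‖) := by
          rw [abs_mul, abs_mul]
          gcongr
          exact abs_real_inner_le_norm _ _
      _ ≤ ρ ^ 2 * ‖D x - D z‖ ^ 2 + (|θ ^ 2 / ρ - ρ| * ‖D z‖ / 2) ^ 2 := by
          nlinarith [sq_nonneg (|ρ| * ‖D x - D z‖ - |θ ^ 2 / ρ - ρ| * ‖D z‖ / 2), sq_abs ρ]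
  linarith [hL (T x - T z)]

theorem tendsto_sq_div_sub_self (θ : ℝ) :
    Tendsto (fun ρ : ℝ => θ ^ 2 / ρ - ρ) (𝓝 θ) (𝓝 0) := by
  have h_cont : ContinuousAt (fun ρ : ℝ => θ ^ 2 / ρ - ρ) θ := by
    rcases eq_or_ne θ 0 with rfl | hθ
    · simp only [ne_eq, OfNat.ofNat_ne_zero, not_false_eq_true, zero_pow, zero_div]
      fun_prop
    · fun_prop (disch := assumption)
  have h_zero : θ ^ 2 / θ - θ = 0 := by rw [sq, mul_self_div_self, sub_self]
  rw [← h_zero]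
  exact h_cont.tendsto

theorem continuous_of_isWeakSolution {α : ℝ} (hα : 0 < α)
    (hL : ∀ q, α * ‖q‖ ^ 2 ≤ inner ℝ (L q) q) {p : ℝ → K}
    (hp0 : p 0 ∈ closure (Set.range T)) (hp0_eq : ∀ v, inner ℝ (L (e + p 0)) (T v) = 0)
    (hp : ∀ ρ ≠ 0, ∃ x, IsWeakSolution D T L e ρ x ∧ T x = p ρ) : Continuous p := by
  refine continuous_iff_continuousAt.2 fun θ => continuousAt_iff_punctured_nhds.2 ?_
  have h_approx (δ : ℝ) (hδ : 0 < δ) : ∃ z, ‖T z - p θ‖ < δ ∧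
      ∀ v, θ ^ 2 * inner ℝ (D z) (D v) + inner ℝ (L (e + p θ)) (T v) = 0 := by
    rcases eq_or_ne θ 0 with rfl | hθ
    · obtain ⟨_, ⟨z, rfl⟩, hz⟩ := Metric.mem_closure_iff.1 hp0 δ hδ
      exact ⟨z, by rwa [← dist_eq_norm, dist_comm], fun v => by
        rw [hp0_eq, add_zero, sq, zero_mul, zero_mul]⟩
    · obtain ⟨z, hz, hzp⟩ := hp θ hθ
      exact ⟨z, by simpa [hzp] using hδ, hzp ▸ hz⟩
  rw [Metric.tendsto_nhds]
  intro ε hε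
  obtain ⟨z, hz_lt, hz⟩ := h_approx (ε / 2 / (1 + ‖L‖ / α)) (by positivity)
  rw [lt_div_iff₀ (by positivity)] at hz_lt
  have h_limit : Tendsto (fun ρ : ℝ => |θ ^ 2 / ρ - ρ| * ‖D z‖ / 2 / √α) (𝓝 θ) (𝓝 0) := by
    have h_abs := (tendsto_sq_div_sub_self θ).abs
    simpa using ((h_abs.mul_const ‖D z‖).div_const 2).div_const √α
  have h_ne : ∀ᶠ ρ in 𝓝[≠] θ, ρ ≠ 0 := by
    rcases eq_or_ne θ 0 with rfl | hθ
    · exact self_mem_nhdsWithin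
    · exact nhdsWithin_le_nhds (isOpen_ne.mem_nhds hθ)
  filter_upwards [h_ne, nhdsWithin_le_nhds (h_limit.eventually_lt_const (half_pos hε))]
    with ρ hρ h_lt
  obtain ⟨x, hx, hxp⟩ := hp ρ hρ
  have h_cea := hx.norm_map_sub_le hα hL hρ hz
  rw [hxp] at h_cea
  calc dist (p ρ) (p θ) ≤ ‖p ρ - T z‖ + ‖T z - p θ‖ := by
        rw [dist_eq_norm]
        exact norm_sub_le_norm_sub_add_norm_sub _ _ _
    _ ≤ ‖T z - p θ‖ * (1 + ‖L‖ / α) + |θ ^ 2 / ρ - ρ| * ‖D z‖ / 2 / √α := by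
        linarith [show ‖L‖ * ‖T z - p θ‖ / α = ‖T z - p θ‖ * (‖L‖ / α) by ring]
    _ < ε := by linarith

theorem IsWeakSolution.sq_mul_norm_map_le {C : ℝ} (hL : ∀ q, 0 ≤ inner ℝ (L q) q)
    (hT : ∀ v, ‖T v‖ ≤ C * ‖D v‖) {x : V} (hx : IsWeakSolution D T L e ρ x) :
    ρ ^ 2 * ‖T x‖ ≤ C ^ 2 * ‖L e‖ := by
  rcases (norm_nonneg (T x)).eq_or_lt with h | h_pos
  · rw [← h, mul_zero]
    positivity
  have h_energy : ρ ^ 2 * ‖D x‖ ^ 2 ≤ ‖L e‖ * ‖T x‖ := by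
    have h_x := hx x
    rw [real_inner_self_eq_norm_sq, map_add, inner_add_left] at h_x
    linarith [hL (T x), (neg_le_abs _).trans (abs_real_inner_le_norm (L e) (T x))]
  refine le_of_mul_le_mul_right ?_ h_pos
  calc ρ ^ 2 * ‖T x‖ * ‖T x‖ = ρ ^ 2 * ‖T x‖ ^ 2 := by ring
    _ ≤ ρ ^ 2 * (C * ‖D x‖) ^ 2 := by
        gcongr
        exact hT x
    _ = C ^ 2 * (ρ ^ 2 * ‖D x‖ ^ 2) := by ring
    _ ≤ C ^ 2 * (‖L e‖ * ‖T x‖) := by gcongr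
    _ = C ^ 2 * ‖L e‖ * ‖T x‖ := by ring

theorem tendsto_cocompact_of_isWeakSolution {C : ℝ} (hL : ∀ q, 0 ≤ inner ℝ (L q) q)
    (hT : ∀ v, ‖T v‖ ≤ C * ‖D v‖) {p : ℝ → K}
    (hp : ∀ ρ ≠ 0, ∃ x, IsWeakSolution D T L e ρ x ∧ T x = p ρ) :
    Tendsto p (cocompact ℝ) (𝓝 0) := by
  have h_bound : ∀ᶠ ρ in cocompact ℝ, ‖p ρ‖ ≤ C ^ 2 * ‖L e‖ / ρ ^ 2 := by
    filter_upwards [(isCompact_singleton (x := (0 : ℝ))).compl_mem_cocompact] with ρ hρ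
    obtain ⟨x, hx, hxp⟩ := hp ρ hρ
    rw [le_div_iff₀ (sq_pos_of_ne_zero hρ), mul_comm, ← hxp]
    exact hx.sq_mul_norm_map_le hL hT
  refine squeeze_zero_norm' h_bound ?_
  have h_sq : Tendsto (fun ρ : ℝ => ρ ^ 2) (cocompact ℝ) atTop := by
    simpa only [Function.comp_def, Real.norm_eq_abs, sq_abs] using
      (tendsto_pow_atTop two_ne_zero).comp (tendsto_norm_cocompact_atTop (E := ℝ))
  exact h_sq.const_div_atTop _

end Variational

section Multiplication

variable {α ι : Type*} [MeasurableSpace α] {μ : Measure α}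

/-- `p` is the class of the vector field `P` in `L²`. -/
def Represents (P : α → ι → ℝ) (p : PiLp 2 fun _ : ι => Lp ℝ 2 μ) : Prop :=
  ∀ m, (fun y => P y m) =ᵐ[μ] p m

namespace Represents

variable {P Q : α → ι → ℝ} {p q : PiLp 2 fun _ : ι => Lp ℝ 2 μ}

theorem add (hP : Represents P p) (hQ : Represents Q q) : Represents (P + Q) (p + q) :=
  fun m => ((hP m).add (hQ m)).trans (Lp.coeFn_add _ _).symm

theorem memLp (hP : Represents P p) (m : ι) : MemLp (fun y => P y m) 2 μ :=
  (memLp_congr_ae (hP m)).2 (Lp.memLp (p m))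

theorem integrable_mul (hP : Represents P p) (hQ : Represents Q q) (m : ι) :
    Integrable (fun y => P y m * Q y m) μ := (hP.memLp m).integrable_mul (hQ.memLp m)

end Represents

variable [Fintype ι]

/-- Multiplication of square integrable vector fields by an essentially bounded matrix field. -/
def mulVecL {A : α → Matrix ι ι ℝ} (hA : ∀ k l, MemLp (fun y => A y k l) ∞ μ) :
    (PiLp 2 fun _ : ι => Lp ℝ 2 μ) →L[ℝ] PiLp 2 fun _ : ι => Lp ℝ 2 μ :=
  (PiLp.continuousLinearEquiv 2 ℝ fun _ : ι => Lp ℝ 2 μ).symm.toContinuousLinearMap ∘L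
    ContinuousLinearMap.pi fun k => ∑ l,
      (ContinuousLinearMap.mul ℝ ℝ).holderL μ ∞ 2 2 ((hA k l).toLp _) ∘L
        PiLp.proj 2 (fun _ : ι => Lp ℝ 2 μ) l

namespace Represents

variable {P Q : α → ι → ℝ} {p q : PiLp 2 fun _ : ι => Lp ℝ 2 μ}

theorem mulVec {A : α → Matrix ι ι ℝ} (hA : ∀ k l, MemLp (fun y => A y k l) ∞ μ)
    (hP : Represents P p) : Represents (fun y => A y *ᵥ P y) (mulVecL hA p) := fun k => by
  have h_entry (l : ι) : (ContinuousLinearMap.mul ℝ ℝ).holder 2 ((hA k l).toLp _) (p l) =ᵐ[μ]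
      fun y => A y k l * P y l := by
    filter_upwards [(ContinuousLinearMap.mul ℝ ℝ).coeFn_holder (r := 2) ((hA k l).toLp _) (p l),
      (hA k l).coeFn_toLp, hP l] with y h_holder h_coeff h_field
    rw [h_holder, h_coeff, h_field, ContinuousLinearMap.mul_apply']
  have h_row : mulVecL hA p k =
      ∑ l, (ContinuousLinearMap.mul ℝ ℝ).holder 2 ((hA k l).toLp _) (p l) := by
    simp [mulVecL]
  rw [h_row]
  filter_upwards [Lp.coeFn_finsetSum Finset.univ fun l =>
      (ContinuousLinearMap.mul ℝ ℝ).holder 2 ((hA k l).toLp _) (p l),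
    ae_all_iff.2 h_entry] with y h_sum h_entries
  rw [h_sum, Finset.sum_apply]
  exact (Finset.sum_congr rfl fun l _ => h_entries l).symm

theorem integrable_dotProduct (hP : Represents P p) (hQ : Represents Q q) :
    Integrable (fun y => P y ⬝ᵥ Q y) μ :=
  integrable_finsetSum _ fun m _ => hP.integrable_mul hQ m

theorem integral_dotProduct (hP : Represents P p) (hQ : Represents Q q) :
    ∫ y, P y ⬝ᵥ Q y ∂μ = inner ℝ p q := by
  simp only [dotProduct]
  rw [integral_finsetSum _ fun m _ => hP.integrable_mul hQ m, PiLp.inner_apply]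
  exact Finset.sum_congr rfl fun m _ => integral_mul_eq_inner (hP m) (hQ m)

end Represents

theorem mul_norm_sq_le_inner_mulVecL {A : α → Matrix ι ι ℝ}
    (hA : ∀ k l, MemLp (fun y => A y k l) ∞ μ) {c : ℝ}
    (h : ∀ᵐ y ∂μ, ∀ ξ : ι → ℝ, c * (ξ ⬝ᵥ ξ) ≤ (A y *ᵥ ξ) ⬝ᵥ ξ)
    (p : PiLp 2 fun _ : ι => Lp ℝ 2 μ) : c * ‖p‖ ^ 2 ≤ inner ℝ (mulVecL hA p) p := by
  have hp : Represents (fun y m => p m y) p := fun _ => ae_eq_rfl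
  rw [← real_inner_self_eq_norm_sq, ← hp.integral_dotProduct hp,
    ← (hp.mulVec hA).integral_dotProduct hp, ← integral_const_mul]
  exact integral_mono_ae ((hp.integrable_dotProduct hp).const_mul c)
    ((hp.mulVec hA).integrable_dotProduct hp) (h.mono fun y hy => hy _)

end Multiplication

/-- Coefficient fields that are essentially bounded and uniformly elliptic on the periodicity
cell, which is the class for which the cell problems are treated. -/
structure IsEllipticOnCell (A : (Fin d → ℝ) → Matrix (Fin d) (Fin d) ℝ) : Prop where
  memLp_top : ∀ k l, MemLp (fun y => A y k l) ∞ (cellMeasure d)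
  elliptic : ∃ α : ℝ, 0 < α ∧
    ∀ᵐ y ∂cellMeasure d, ∀ ξ : Fin d → ℝ, α * (ξ ⬝ᵥ ξ) ≤ (A y *ᵥ ξ) ⬝ᵥ ξ

theorem IsAdmissible.isEllipticOnCell {A : (Fin d → ℝ) → Matrix (Fin d) (Fin d) ℝ}
    (hA : IsAdmissible A) : IsEllipticOnCell A where
  memLp_top k l := by
    obtain ⟨M, hM⟩ := hA.bounded
    exact memLp_top_of_bound (hA.measurable k l).restrict.aestronglyMeasurable M
      (ae_restrict_of_ae (hM.mono fun y hy => hy k l))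
  elliptic := hA.elliptic.imp fun _ h => ⟨h.1, ae_restrict_of_ae h.2⟩

/-- The constant coordinate vector field `e_j`. -/
def coordField (j : Fin d) : L2Field d :=
  WithLp.toLp 2 fun m => (memLp_const ((Pi.single j 1 : Fin d → ℝ) m)).toLp _

theorem represents_coordField (j : Fin d) :
    Represents (fun _ => Pi.single j 1) (coordField j) :=
  fun m => (memLp_const ((Pi.single j 1 : Fin d → ℝ) m)).coeFn_toLp.symm

theorem MemH1.represents_weakGrad {u : (Fin d → ℝ) → ℝ} (hu : MemH1 u) :
    Represents (weakGrad u) (Sobolev1.grad d hu.toSobolev1) :=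
  fun m => (hu.isWeakPartial m).1.2.coeFn_toLp.symm

theorem MemEnergy.memH1 {ρ : ℝ} {u : (Fin d → ℝ) → ℝ} (hu : MemEnergy ρ u) : MemH1 u :=
  hu.elim (fun h => h.2) fun h => h.2.memH1

theorem memEnergy_zero_iff {u : (Fin d → ℝ) → ℝ} : MemEnergy 0 u ↔ MemH1 u := by
  simp [MemEnergy]

theorem memEnergy_iff_of_ne_zero {ρ : ℝ} (hρ : ρ ≠ 0) {u : (Fin d → ℝ) → ℝ} :
    MemEnergy ρ u ↔ MemH2 u := by
  simp [MemEnergy, hρ]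

namespace IsEllipticOnCell

variable {A : (Fin d → ℝ) → Matrix (Fin d) (Fin d) ℝ}

/-- Multiplication by the coefficient field `A`, as an operator on square integrable fields. -/
def fluxOp (hA : IsEllipticOnCell A) : L2Field d →L[ℝ] L2Field d := mulVecL hA.memLp_top

theorem exists_coercive (hA : IsEllipticOnCell A) :
    ∃ α : ℝ, 0 < α ∧ ∀ p, α * ‖p‖ ^ 2 ≤ inner ℝ (hA.fluxOp p) p :=
  hA.elliptic.imp fun _ h => ⟨h.1, mul_norm_sq_le_inner_mulVecL hA.memLp_top h.2⟩

theorem integral_flux_dotProduct (hA : IsEllipticOnCell A) {P Q : (Fin d → ℝ) → Fin d → ℝ}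
    {p q : L2Field d} (hP : Represents P p) (hQ : Represents Q q) (j : Fin d) :
    ∫ y in cell d, (A y *ᵥ (Pi.single j 1 + P y)) ⬝ᵥ Q y =
      inner ℝ (hA.fluxOp (coordField j + p)) q :=
  (((represents_coordField j).add hP).mulVec hA.memLp_top).integral_dotProduct hQ

theorem isCorrector_zero_iff (hA : IsEllipticOnCell A) {j : Fin d} {χ : (Fin d → ℝ) → ℝ}
    (hχ : MemH1 χ) : IsCorrector A 0 j χ ↔ ⨍ y in cell d, χ y = 0 ∧
      IsWeakSolution (0 : Sobolev1 d →L[ℝ] L2Cell d) (Sobolev1.grad d) hA.fluxOp (coordField j) 0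
        hχ.toSobolev1 := by
  have h_weak {v : (Fin d → ℝ) → ℝ} (hv : MemH1 v) :=
    hA.integral_flux_dotProduct hχ.represents_weakGrad hv.represents_weakGrad j
  simp only [IsCorrector, memEnergy_zero_iff, hχ, true_and]
  refine and_congr_right fun _ => ⟨fun h v => ?_, fun h v hv => ?_⟩
  · have h_v := h _ (memH1_periodize v)
    rw [h_weak (memH1_periodize v), toSobolev1_periodize] at h_v
    simpa using h_v
  · rw [h_weak hv]
    simpa using h hv.toSobolev1

theorem isCorrector_iff_of_ne_zero (hA : IsEllipticOnCell A) {ρ : ℝ} (hρ : ρ ≠ 0) {j : Fin d}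
    {χ : (Fin d → ℝ) → ℝ} (hχ : MemH2 χ) : IsCorrector A ρ j χ ↔ ⨍ y in cell d, χ y = 0 ∧
      IsWeakSolution (Sobolev2.laplacian d) (Sobolev2.grad d) hA.fluxOp (coordField j) ρ
        hχ.toSobolev2 := by
  have h_weak {v : (Fin d → ℝ) → ℝ} (hv : MemH2 v) :
      ρ ^ 2 * (∫ y in cell d, weakLaplacian χ y * weakLaplacian v y) +
          (∫ y in cell d, (A y *ᵥ (Pi.single j 1 + weakGrad χ y)) ⬝ᵥ weakGrad v y) =
        ρ ^ 2 * inner ℝ (Sobolev2.laplacian d hχ.toSobolev2) (Sobolev2.laplacian d hv.toSobolev2) +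
          inner ℝ (hA.fluxOp (coordField j + Sobolev2.grad d hχ.toSobolev2))
            (Sobolev2.grad d hv.toSobolev2) := by
    rw [integral_mul_eq_inner hχ.laplacian_toSobolev2_ae_eq.symm
      hv.laplacian_toSobolev2_ae_eq.symm, hA.integral_flux_dotProduct
      hχ.memH1.represents_weakGrad hv.memH1.represents_weakGrad, hχ.grad_toSobolev2,
      hv.grad_toSobolev2]
  simp only [IsCorrector, memEnergy_iff_of_ne_zero hρ, hχ, true_and]
  refine and_congr_right fun _ => ⟨fun h v => ?_, fun h v hv => ?_⟩
  · obtain ⟨w, hw, rfl⟩ : ∃ w, ∃ hw : MemH2 w, hw.toSobolev2 = v :=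
      ⟨_, memH2_periodize v, toSobolev2_periodize v⟩
    exact (h_weak hw).symm.trans (h w hw)
  · exact (h_weak hv).trans (h hv.toSobolev2)

theorem existsUnique_isWeakSolution_zero (hA : IsEllipticOnCell A) (e : L2Field d) :
    ∃! x : Sobolev1 d,
      IsWeakSolution (0 : Sobolev1 d →L[ℝ] L2Cell d) (Sobolev1.grad d) hA.fluxOp e 0 x := by
  obtain ⟨α, hα, h_coercive⟩ := hA.exists_coercive
  refine existsUnique_isWeakSolution e (half_pos hα) fun x => ?_
  calc α / 2 * ‖x‖ ^ 2 ≤ α / 2 * (2 * ‖Sobolev1.grad d x‖ ^ 2) := by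
        gcongr
        exact Sobolev1.norm_sq_le x
    _ = α * ‖Sobolev1.grad d x‖ ^ 2 := by ring
    _ ≤ inner ℝ (hA.fluxOp (Sobolev1.grad d x)) (Sobolev1.grad d x) := h_coercive _
    _ = _ := by ring

theorem inner_fluxOp_nonneg (hA : IsEllipticOnCell A) (p : L2Field d) :
    0 ≤ inner ℝ (hA.fluxOp p) p := by
  obtain ⟨α, hα, h_coercive⟩ := hA.exists_coercive
  exact le_trans (by positivity) (h_coercive p)

theorem existsUnique_isWeakSolution_of_ne_zero (hA : IsEllipticOnCell A) {ρ : ℝ} (hρ : ρ ≠ 0)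
    (e : L2Field d) :
    ∃! x : Sobolev2 d, IsWeakSolution (Sobolev2.laplacian d) (Sobolev2.grad d) hA.fluxOp e ρ x := by
  refine existsUnique_isWeakSolution e (c := ρ ^ 2 / 4) (by positivity) fun x => ?_
  calc ρ ^ 2 / 4 * ‖x‖ ^ 2 ≤ ρ ^ 2 / 4 * (4 * ‖Sobolev2.laplacian d x‖ ^ 2) := by
        gcongr
        exact Sobolev2.norm_sq_le x
    _ = ρ ^ 2 * ‖Sobolev2.laplacian d x‖ ^ 2 := by ring
    _ ≤ _ := le_add_of_nonneg_right (hA.inner_fluxOp_nonneg _)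

theorem exists_isCorrector (hA : IsEllipticOnCell A) (ρ : ℝ) (j : Fin d) :
    ∃ χ, IsCorrector A ρ j χ := by
  rcases eq_or_ne ρ 0 with rfl | hρ
  · obtain ⟨x, hx, -⟩ := hA.existsUnique_isWeakSolution_zero (coordField j)
    refine ⟨_, (hA.isCorrector_zero_iff (memH1_periodize x)).2
      ⟨average_periodize (Sobolev1.cellFourierCoeff_zero_value x), ?_⟩⟩
    rwa [toSobolev1_periodize]
  · obtain ⟨x, hx, -⟩ := hA.existsUnique_isWeakSolution_of_ne_zero hρ (coordField j)
    refine ⟨_, (hA.isCorrector_iff_of_ne_zero hρ (memH2_periodize x)).2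
      ⟨average_periodize (Sobolev1.cellFourierCoeff_zero_value (Sobolev2.toSobolev1 d x)), ?_⟩⟩
    rwa [toSobolev2_periodize]

theorem ae_eq_of_isCorrector (hA : IsEllipticOnCell A) {ρ : ℝ} {j : Fin d}
    {χ χ' : (Fin d → ℝ) → ℝ} (h : IsCorrector A ρ j χ) (h' : IsCorrector A ρ j χ') :
    χ =ᵐ[volume] χ' := by
  refine MemH1.ae_eq_of_toSobolev1_eq h.1.memH1 h'.1.memH1 h.2.1 h'.2.1 ?_
  rcases eq_or_ne ρ 0 with rfl | hρ
  · exact (hA.existsUnique_isWeakSolution_zero (coordField j)).unique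
      ((hA.isCorrector_zero_iff h.1.memH1).1 h).2 ((hA.isCorrector_zero_iff h'.1.memH1).1 h').2
  · have hχ := (memEnergy_iff_of_ne_zero hρ).1 h.1
    have hχ' := (memEnergy_iff_of_ne_zero hρ).1 h'.1
    exact congrArg (Sobolev2.toSobolev1 d)
      ((hA.existsUnique_isWeakSolution_of_ne_zero hρ (coordField j)).unique
        ((hA.isCorrector_iff_of_ne_zero hρ hχ).1 h).2
        ((hA.isCorrector_iff_of_ne_zero hρ hχ').1 h').2)

theorem isCorrector_corrector (hA : IsEllipticOnCell A) (ρ : ℝ) (j : Fin d) :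
    IsCorrector A ρ j (corrector A ρ j) := by
  rw [corrector, dif_pos (hA.exists_isCorrector ρ j)]
  exact (hA.exists_isCorrector ρ j).choose_spec

/-- The gradient `∇χ_j^ρ` of the corrector, as a square integrable field. -/
def correctorGrad (hA : IsEllipticOnCell A) (j : Fin d) (ρ : ℝ) : L2Field d :=
  Sobolev1.grad d (hA.isCorrector_corrector ρ j).1.memH1.toSobolev1

theorem represents_correctorGrad (hA : IsEllipticOnCell A) (j : Fin d) (ρ : ℝ) :
    Represents (weakGrad (corrector A ρ j)) (hA.correctorGrad j ρ) :=
  MemH1.represents_weakGrad _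

theorem exists_isWeakSolution_correctorGrad (hA : IsEllipticOnCell A) (j : Fin d) {ρ : ℝ}
    (hρ : ρ ≠ 0) : ∃ x : Sobolev2 d,
      IsWeakSolution (Sobolev2.laplacian d) (Sobolev2.grad d) hA.fluxOp (coordField j) ρ x ∧
        Sobolev2.grad d x = hA.correctorGrad j ρ :=
  have h := hA.isCorrector_corrector ρ j
  have hχ := (memEnergy_iff_of_ne_zero hρ).1 h.1
  ⟨hχ.toSobolev2, ((hA.isCorrector_iff_of_ne_zero hρ hχ).1 h).2, rfl⟩

theorem inner_fluxOp_correctorGrad_zero (hA : IsEllipticOnCell A) (j : Fin d) (v : Sobolev1 d) :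
    inner ℝ (hA.fluxOp (coordField j + hA.correctorGrad j 0)) (Sobolev1.grad d v) = 0 := by
  have h := hA.isCorrector_corrector 0 j
  simpa [correctorGrad] using ((hA.isCorrector_zero_iff h.1.memH1).1 h).2 v

theorem continuous_correctorGrad (hA : IsEllipticOnCell A) (j : Fin d) :
    Continuous (hA.correctorGrad j) := by
  obtain ⟨α, hα, h_coercive⟩ := hA.exists_coercive
  exact continuous_of_isWeakSolution hα h_coercive (grad_mem_closure_range _)
    (fun v => hA.inner_fluxOp_correctorGrad_zero j (Sobolev2.toSobolev1 d v))
    fun _ => hA.exists_isWeakSolution_correctorGrad j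

theorem tendsto_correctorGrad_cocompact (hA : IsEllipticOnCell A) (j : Fin d) :
    Tendsto (hA.correctorGrad j) (cocompact ℝ) (𝓝 0) :=
  tendsto_cocompact_of_isWeakSolution (C := 1) hA.inner_fluxOp_nonneg
    (fun v => (Sobolev2.norm_grad_le v).trans_eq (one_mul _).symm)
    fun _ => hA.exists_isWeakSolution_correctorGrad j

theorem average_flux (hA : IsEllipticOnCell A) {P : (Fin d → ℝ) → Fin d → ℝ} {p : L2Field d}
    (hP : Represents P p) (k l : Fin d) :
    ⨍ y in cell d, (A y k l + (A y *ᵥ P y) k) =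
      ((2 * Real.pi) ^ d)⁻¹ * inner ℝ (hA.fluxOp (coordField l + p)) (coordField k) := by
  rw [average_cell, ← hA.integral_flux_dotProduct hP (represents_coordField k)]
  simp [Matrix.mulVec_add]

theorem homTensor_apply (hA : IsEllipticOnCell A) (ρ : ℝ) (k l : Fin d) : homTensor A ρ k l =
    ((2 * Real.pi) ^ d)⁻¹ *
      inner ℝ (hA.fluxOp (coordField l + hA.correctorGrad l ρ)) (coordField k) :=
  hA.average_flux (hA.represents_correctorGrad l ρ) k l

theorem meanMatrix_apply (hA : IsEllipticOnCell A) (k l : Fin d) : meanMatrix A k l =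
    ((2 * Real.pi) ^ d)⁻¹ * inner ℝ (hA.fluxOp (coordField l + 0)) (coordField k) := by
  have h_zero : Represents (fun _ : Fin d → ℝ => (0 : Fin d → ℝ)) (0 : L2Field d) :=
    fun _ => (Lp.coeFn_zero ℝ 2 (cellMeasure d)).symm
  simpa [meanMatrix] using! hA.average_flux h_zero k l

theorem continuous_homTensor (hA : IsEllipticOnCell A) : Continuous (homTensor A) := by
  refine continuous_pi fun k => continuous_pi fun l => ?_
  have h_grad := hA.continuous_correctorGrad l
  simp only [hA.homTensor_apply]
  fun_prop

theorem tendsto_homTensor_cocompact (hA : IsEllipticOnCell A) :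
    Tendsto (homTensor A) (cocompact ℝ) (𝓝 (meanMatrix A)) := by
  refine tendsto_pi_nhds.2 fun k => tendsto_pi_nhds.2 fun l => ?_
  have h_cont : Continuous fun p : L2Field d =>
      ((2 * Real.pi) ^ d)⁻¹ * inner ℝ (hA.fluxOp (coordField l + p)) (coordField k) := by fun_prop
  simp only [hA.homTensor_apply, hA.meanMatrix_apply]
  exact (h_cont.tendsto 0).comp (hA.tendsto_correctorGrad_cocompact l)

theorem tendsto_homTensor (hA : IsEllipticOnCell A) (θ : ℝ≥0∞) :
    Tendsto (fun ρ : ℝ≥0 => homTensor A ρ) (comap (↑) (𝓝 θ)) (𝓝 (limitTensor A θ)) := by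
  rcases eq_or_ne θ ⊤ with rfl | hθ
  · have h_atTop : Tendsto ((↑) : ℝ≥0 → ℝ) (comap (↑) (𝓝 (⊤ : ℝ≥0∞))) (cocompact ℝ) :=
      (NNReal.tendsto_coe_atTop.2 (ENNReal.tendsto_coe_nhds_top.1 tendsto_comap)).mono_right
        atTop_le_cocompact
    rw [limitTensor, if_pos rfl]
    exact hA.tendsto_homTensor_cocompact.comp h_atTop
  · lift θ to ℝ≥0 using hθ
    have h_nhds : Tendsto ((↑) : ℝ≥0 → ℝ) (comap (↑) (𝓝 (θ : ℝ≥0∞))) (𝓝 (θ : ℝ)) :=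
      NNReal.tendsto_coe.2 (ENNReal.tendsto_coe.1 tendsto_comap)
    rw [limitTensor, if_neg ENNReal.coe_ne_top, ENNReal.coe_toReal]
    exact (hA.continuous_homTensor.tendsto _).comp h_nhds

end IsEllipticOnCell

end

end PeriodicHom

theorem theorem5p3_general {d : ℕ} {A : (Fin d → ℝ) → Matrix (Fin d) (Fin d) ℝ}
    (hA : PeriodicHom.IsEllipticOnCell A) :
    (∀ (ρ : ℝ) (j : Fin d),
      (∃ χ, PeriodicHom.IsCorrector A ρ j χ) ∧
      ∀ χ χ' : (Fin d → ℝ) → ℝ, PeriodicHom.IsCorrector A ρ j χ →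
        PeriodicHom.IsCorrector A ρ j χ' → χ =ᵐ[volume] χ') ∧
    ∀ (θ : ℝ≥0∞) {ι : Type*} (l : Filter ι) (ρ : ι → ℝ≥0),
      Tendsto (fun i => (ρ i : ℝ≥0∞)) l (𝓝 θ) →
      Tendsto (fun i => PeriodicHom.homTensor A (ρ i)) l
        (𝓝 (PeriodicHom.limitTensor A θ)) :=
  ⟨fun ρ j => ⟨hA.exists_isCorrector ρ j, fun _ _ => hA.ae_eq_of_isCorrector⟩,
    fun θ _ _ _ hρ => (hA.tendsto_homTensor θ).comp (tendsto_comap_iff.2 hρ)⟩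

theorem theorem5p3 {d : ℕ} (A : (Fin d → ℝ) → Matrix (Fin d) (Fin d) ℝ)
    (hA : PeriodicHom.IsAdmissible A) :
    (∀ (ρ : ℝ≥0) (j : Fin d),
      (∃ χ, PeriodicHom.IsCorrector A ρ j χ) ∧
      ∀ χ χ' : (Fin d → ℝ) → ℝ, PeriodicHom.IsCorrector A ρ j χ →
        PeriodicHom.IsCorrector A ρ j χ' → χ =ᵐ[volume] χ') ∧
    ∀ (θ : ℝ≥0∞) {ι : Type*} (l : Filter ι) (ρ : ι → ℝ≥0),
      Tendsto (fun i => (ρ i : ℝ≥0∞)) l (𝓝 θ) →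
      Tendsto (fun i => PeriodicHom.homTensor A (ρ i)) l
        (𝓝 (PeriodicHom.limitTensor A θ)) :=
  have h := theorem5p3_general hA.isEllipticOnCell
  ⟨fun ρ => h.1 ρ, h.2⟩
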